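/- Let $\varepsilon,\gamma\in\mathbb R\setminus\{0\}$ and consider the 2D viscoelastic equation $$u_{tt}-\varepsilon\,\partial_t\Delta u-\gamma\,\Delta u=f,\qquad \Delta=\partial_x^2+\partial_y^2,$$ as one equation for two dependent variables $u,f$ of the independent variables $x,y,t$. Let $M\subseteq\mathbb R^3\times\mathbb R^2$ be an open connected subset of the space with coordinates $(x,y,t;u,f)$ whose fibres over points $(x,y,t)$ are connected (for instance $M=\mathbb R^5$), and let $\Omega\subseteq\mathbb R^3$ be its projection to $(x,y,t)$-space. A smooth vector field $$V=\xi^1\partial_x+\xi^2\partial_y+\xi^3\partial_t+\phi_1\partial_u+\phi_2\partial_f$$ on $M$, with coefficients depending on $(x,y,t,u,f)$, is called an infinitesimal point symmetry of the equation if its third prolongation satisfies $$\mathrm{Pr}^{(3)}V\,[\,u_{tt}-\varepsilon\,\partial_t\Delta u-\gamma\,\Delta u-f\,]=0\quad\text{whenever}\quad u_{tt}-\varepsilon\,\partial_t\Delta u-\gamma\,\Delta u-f=0$$ (at all 3-jets over $M$). Then $V$ is an infinitesimal point symmetry if and only if there are constants $c_1,\dots,c_5\in\mathbb R$ and a smooth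 function $F_2:\Omega\to\mathbb R$ such that on $M$ $$\xi^1=c_1y+c_2,\qquad \xi^2=-c_1x+c_3,\qquad \xi^3=c_4,$$ $$\phi_1=c_5u+F_2(x,y,t),\qquad \phi_2=c_5f+\partial_t^2F_2-\varepsilon\,\partial_t\Delta F_2-\gamma\,\Delta F_2 .$$ Moreover, the infinitesimal point symmetries on $M$ form a real Lie algebra: they are closed under linear combinations and under the Lie bracket of vector fields. -/

import Mathlib

open scoped ContDiff

noncomputable section

namespace Viscoelastic

/-- Space of independent variables `(x, y, t)`, with indices `0, 1, 2`. -/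
abbrev Base : Type := Fin 3 → ℝ

/-- Space of dependent variables `(u, f)`, with indices `0, 1`. -/
abbrev Fibre : Type := Fin 2 → ℝ

/-- Total space with coordinates `((x, y, t), (u, f))`. -/
abbrev Total : Type := Base × Fibre

/-- Multi-indices of partial derivatives in `(x, y, t)`. -/
abbrev MultiIndex : Type := Fin 3 → ℕ

/-- Jet space: `z.1` is the base point and `z.2 α J` is the jet coordinate `u^α_J`,
where `u^0 = u` and `u^1 = f`. Jets of all orders are collected in one space. -/
abbrev Jet : Type := Base × (Fin 2 → MultiIndex → ℝ)

/-- The projection of a jet to the total space. -/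
def proj (z : Jet) : Total := (z.1, fun α => z.2 α 0)

/-- The multi-index `e_k`. -/
def unitIndex (k : Fin 3) : MultiIndex := Pi.single k 1

/-- The vector `∂_{x^k} + ∑_{α, J} u^α_{J + e_k} ∂_{u^α_J}` at the jet `z`. -/
def shift (k : Fin 3) (z : Jet) : Jet :=
  (Pi.single k 1, fun α J => z.2 α (J + unitIndex k))

/-- The total derivative `D_k P = ∂P/∂x^k + ∑_{α, J} u^α_{J + e_k} ∂P/∂u^α_J`, which for a
differentiable function of finitely many jet coordinates is the derivative of `P` at `z`
in the direction `shift k z`. -/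
def totalDeriv (k : Fin 3) (P : Jet → ℝ) : Jet → ℝ :=
  fun z => lineDeriv ℝ P z (shift k z)

/-- The iterated total derivative `D^J`. -/
def totalDerivIter (J : MultiIndex) (P : Jet → ℝ) : Jet → ℝ :=
  (totalDeriv 0)^[J 0] ((totalDeriv 1)^[J 1] ((totalDeriv 2)^[J 2] P))

/-- The characteristic `Q_α = φ_α - ∑ i, ξ^i u^α_i` of the vector field
`V = ∑ i, ξ^i ∂_{x^i} + ∑ α, φ_α ∂_{u^α}`, where `V p = (ξ p, φ p)`. -/
def characteristic (V : Total → Total) (α : Fin 2) (z : Jet) : ℝ :=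
  (V (proj z)).2 α - ∑ i : Fin 3, (V (proj z)).1 i * z.2 α (unitIndex i)

/-- The coefficient `φ_α^J = D^J Q_α + ∑ i, ξ^i u^α_{J + e_i}` of the prolongation. -/
def prolongCoeff (V : Total → Total) (α : Fin 2) (J : MultiIndex) (z : Jet) : ℝ :=
  totalDerivIter J (characteristic V α) z
    + ∑ i : Fin 3, (V (proj z)).1 i * z.2 α (J + unitIndex i)

/-- The prolongation `∑ i, ξ^i ∂_{x^i} + ∑_{α, J} φ_α^J ∂_{u^α_J}` of `V`. -/
def prolong (V : Total → Total) (z : Jet) : Jet :=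
  ((V (proj z)).1, fun α J => prolongCoeff V α J z)

/-- The prolongation of `V` applied, as a derivation, to a function `P` of the jet. If `P`
depends on derivatives of order at most `n` only, this is `Pr^(n) V [P]`. -/
def prolongApply (V : Total → Total) (P : Jet → ℝ) (z : Jet) : ℝ :=
  lineDeriv ℝ P z (prolong V z)

/-- The differential function `u_tt - ε ∂_t (u_xx + u_yy) - γ (u_xx + u_yy) - f`. -/
def equation (ε γ : ℝ) (z : Jet) : ℝ :=
  z.2 0 ![0, 0, 2] - ε * (z.2 0 ![2, 0, 1] + z.2 0 ![0, 2, 1])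
    - γ * (z.2 0 ![2, 0, 0] + z.2 0 ![0, 2, 0]) - z.2 1 0

/-- `V` is a (smooth) infinitesimal point symmetry, on the open set `M` of the total space, of
`u_tt - ε ∂_t Δu - γ Δu = f` with `u` and `f` both dependent variables: the prolongation of `V`
annihilates the equation at every jet over `M` that satisfies the equation. -/
structure IsInfinitesimalSymmetry (ε γ : ℝ) (M : Set Total) (V : Total → Total) : Prop where
  smooth : ContDiffOn ℝ ∞ V M
  invariance : ∀ z : Jet, proj z ∈ M → equation ε γ z = 0 →
    prolongApply V (equation ε γ) z = 0

/-- Partial derivative of a function of `(x, y, t)`. -/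
def pderiv (i : Fin 3) (G : Base → ℝ) : Base → ℝ :=
  fun q => fderiv ℝ G q (Pi.single i 1)

/-- The Laplacian in the space variables `(x, y)`. -/
def laplacian (G : Base → ℝ) : Base → ℝ :=
  fun q => pderiv 0 (pderiv 0 G) q + pderiv 1 (pderiv 1 G) q

/-- The linear operator `G ↦ G_tt - ε ∂_t ΔG - γ ΔG`. -/
def viscoOp (ε γ : ℝ) (G : Base → ℝ) : Base → ℝ :=
  fun q => pderiv 2 (pderiv 2 G) q - ε * pderiv 2 (laplacian G) q - γ * laplacian G q

/-- The vector field with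
`ξ¹ = c₁ y + c₂`, `ξ² = -c₁ x + c₃`, `ξ³ = c₄`, `φ₁ = c₅ u + F`, `φ₂ = c₅ f + L F`. -/
def generator (ε γ c₁ c₂ c₃ c₄ c₅ : ℝ) (F : Base → ℝ) : Total → Total :=
  fun p =>
    (![c₁ * p.1 1 + c₂, -c₁ * p.1 0 + c₃, c₄],
     ![c₅ * p.2 0 + F p.1, c₅ * p.2 1 + viscoOp ε γ F p.1])

end Viscoelastic

end

/-!
The symmetry condition is polynomial in the derivatives of `u` and `f`, so it can be tested one
derivative at a time along directions tangent to the equation manifold. The third-order derivatives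
that enter the condition linearly force `(ξ¹, ξ²)` to be a conformal field of the `(x, y)`-plane,
`ξ³` to be a function of `t`, and `φ₁` to be independent of `f`. The derivatives of order at most
two then tie the rate `D_t ξ³` and the derivatives of `∂φ₁/∂u` to the conformal factor `D_x ξ¹`, and
the two operators `ε ∂_t Δ` and `γ Δ`, which scale differently, force that factor to vanish since
`ε γ ≠ 0`. Hence `ξ` is a planar Killing field plus a translation of `t`, `φ₁ = c₅ u + F`, and the
equation itself gives `φ₂`. Closure under the Lie bracket holds because such fields `ξ` commute
with the operator `∂_t² - ε ∂_t Δ - γ Δ`.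
-/

noncomputable section

namespace Viscoelastic

local notation "𝐃" => totalDeriv

section Calculus

variable {E F : Type*} [NormedAddCommGroup E] [NormedSpace ℝ E] [NormedAddCommGroup F]
  [NormedSpace ℝ F] {s : Set E} {X Y : E → E} {h k : E → F}

/-- The Lie derivative of `h` along the vector field `X`. Partial derivatives are the case of a
constant field; in particular `pderiv k` is `lieDeriv fun _ => Pi.single k 1`. -/
def lieDeriv (X : E → E) (h : E → F) : E → F := fun x => fderiv ℝ h x (X x)

theorem differentiableAt_of_contDiffOn (hs : IsOpen s) (hh : ContDiffOn ℝ ∞ h s) {x : E}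
    (hx : x ∈ s) : DifferentiableAt ℝ h x :=
  (hh.contDiffAt (hs.mem_nhds hx)).differentiableAt (by simp)

theorem contDiffOn_lieDeriv (hs : IsOpen s) (hX : ContDiffOn ℝ ∞ X s)
    (hh : ContDiffOn ℝ ∞ h s) : ContDiffOn ℝ ∞ (lieDeriv X h) s :=
  (hh.fderiv_of_isOpen hs (by simp)).clm_apply hX

theorem contDiffOn_linearComb (hh : ContDiffOn ℝ ∞ h s) (hk : ContDiffOn ℝ ∞ k s) (a b : ℝ) :
    ContDiffOn ℝ ∞ (a • h + b • k) s := (hh.const_smul a).add (hk.const_smul b)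

theorem fderiv_eq_of_eqOn (hs : IsOpen s) (hhk : Set.EqOn h k s) :
    Set.EqOn (fderiv ℝ h) (fderiv ℝ k) s := fun _ hx =>
  (hhk.eventuallyEq_of_mem (hs.mem_nhds hx)).fderiv_eq

theorem lieDeriv_eqOn (hs : IsOpen s) (hhk : Set.EqOn h k s) :
    Set.EqOn (lieDeriv X h) (lieDeriv X k) s := fun x hx => by
  rw [lieDeriv, fderiv_eq_of_eqOn hs hhk hx, lieDeriv]

theorem lieDeriv_linearComb (hs : IsOpen s) (hh : ContDiffOn ℝ ∞ h s)
    (hk : ContDiffOn ℝ ∞ k s) (a b : ℝ) :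
    Set.EqOn (lieDeriv X (a • h + b • k)) (a • lieDeriv X h + b • lieDeriv X k) s := by
  intro x hx
  have hh := (differentiableAt_of_contDiffOn hs hh hx).hasFDerivAt
  have hk := (differentiableAt_of_contDiffOn hs hk hx).hasFDerivAt
  rw [lieDeriv, ((hh.const_smul a).add (hk.const_smul b)).fderiv]
  rfl

theorem lieDeriv_lieDeriv (hs : IsOpen s) (hX : ContDiffOn ℝ ∞ X s) (hY : ContDiffOn ℝ ∞ Y s)
    (hh : ContDiffOn ℝ ∞ h s) :
    Set.EqOn (lieDeriv X (lieDeriv Y h))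
      (lieDeriv Y (lieDeriv X h) + lieDeriv (VectorField.lieBracket ℝ X Y) h) s := by
  intro x hx
  have := VectorField.fderiv_apply_lieBracket (hh.contDiffAt (hs.mem_nhds hx))
    (by simpa using WithTop.coe_le_coe.2 (le_top : (2 : ℕ∞) ≤ ⊤))
    (differentiableAt_of_contDiffOn hs hY hx) (differentiableAt_of_contDiffOn hs hX hx)
  exact (add_eq_of_eq_sub' this).symm

theorem lieDeriv_const_comm (hs : IsOpen s) (hh : ContDiffOn ℝ ∞ h s) (v w : E) :
    Set.EqOn (lieDeriv (fun _ => v) (lieDeriv (fun _ => w) h))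
      (lieDeriv (fun _ => w) (lieDeriv (fun _ => v) h)) s := fun x hx => by
  rw [lieDeriv_lieDeriv hs contDiffOn_const contDiffOn_const hh hx, Pi.add_apply]
  simp [lieDeriv, VectorField.lieBracket]

end Calculus

section LineDeriv

variable {𝕜 E : Type*} [NontriviallyNormedField 𝕜] [AddCommGroup E] [Module 𝕜 E]
  {P Q : E → 𝕜} {z v : E}

theorem lineDeriv_add (hP : LineDifferentiableAt 𝕜 P z v) (hQ : LineDifferentiableAt 𝕜 Q z v) :
    lineDeriv 𝕜 (P + Q) z v = lineDeriv 𝕜 P z v + lineDeriv 𝕜 Q z v :=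
  deriv_add hP hQ

theorem lineDeriv_mul (hP : LineDifferentiableAt 𝕜 P z v) (hQ : LineDifferentiableAt 𝕜 Q z v) :
    lineDeriv 𝕜 (P * Q) z v = lineDeriv 𝕜 P z v * Q z + P z * lineDeriv 𝕜 Q z v :=
  (deriv_mul hP hQ).trans (by simp [lineDeriv])

end LineDeriv

section PartialDerivatives

variable {M : Set Total} {h : Total → ℝ}

/-- The partial derivative of a function on the total space with respect to a base coordinate. -/
def baseDeriv (k : Fin 3) (h : Total → ℝ) : Total → ℝ :=
  lieDeriv (fun _ => (Pi.single k 1, 0)) h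

/-- The partial derivative of a function on the total space with respect to a fibre coordinate. -/
def fibreDeriv (α : Fin 2) (h : Total → ℝ) : Total → ℝ :=
  lieDeriv (fun _ => (0, Pi.single α 1)) h

theorem fderiv_total_apply (p v : Total) : fderiv ℝ h p v
    = ∑ k, v.1 k * baseDeriv k h p + ∑ α, v.2 α * fibreDeriv α h p := by
  have hv : v = ∑ k, v.1 k • ((Pi.single k 1, 0) : Total)
      + ∑ α, v.2 α • ((0, Pi.single α 1) : Total) := by
    ext i <;> fin_cases i <;> simp [Fin.sum_univ_three]
  conv_lhs => rw [hv]
  simp only [map_add, map_sum, map_smul, smul_eq_mul, baseDeriv, fibreDeriv, lieDeriv]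

theorem contDiffOn_baseDeriv (hM : IsOpen M) (hh : ContDiffOn ℝ ∞ h M) (k : Fin 3) :
    ContDiffOn ℝ ∞ (baseDeriv k h) M := contDiffOn_lieDeriv hM contDiffOn_const hh

theorem contDiffOn_fibreDeriv (hM : IsOpen M) (hh : ContDiffOn ℝ ∞ h M) (α : Fin 2) :
    ContDiffOn ℝ ∞ (fibreDeriv α h) M := contDiffOn_lieDeriv hM contDiffOn_const hh

end PartialDerivatives

/-- The coordinate function `u^α_J` on the jet space. -/
def jetCoord (α : Fin 2) (J : MultiIndex) : Jet → ℝ := fun z => z.2 α J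

/-- The differential functions over `M`: the algebra of functions on the jet space generated over
`M` by the smooth functions on `M` and the jet coordinates. -/
inductive IsDifferentialFunction (M : Set Total) : (Jet → ℝ) → Prop
  | comp_proj {h : Total → ℝ} (hh : ContDiffOn ℝ ∞ h M) : IsDifferentialFunction M (h ∘ proj)
  | coord (α : Fin 2) (J : MultiIndex) : IsDifferentialFunction M (jetCoord α J)
  | add {P Q : Jet → ℝ} (hP : IsDifferentialFunction M P) (hQ : IsDifferentialFunction M Q) :
      IsDifferentialFunction M (P + Q)
  | mul {P Q : Jet → ℝ} (hP : IsDifferentialFunction M P) (hQ : IsDifferentialFunction M Q) :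
      IsDifferentialFunction M (P * Q)
  | congr {P Q : Jet → ℝ} (hP : IsDifferentialFunction M P) (hPQ : Set.EqOn P Q (proj ⁻¹' M)) :
      IsDifferentialFunction M Q

/-- The derivative `∑ J, v J ∂P/∂u^α_J` of a function on the jet space in a constant vertical
direction. -/
def verticalDeriv (α : Fin 2) (v : MultiIndex → ℝ) (P : Jet → ℝ) : Jet → ℝ :=
  fun z => lineDeriv ℝ P z (0, Pi.single α v)

/-- The translate `J ↦ v (J + e_k)` of a vertical direction, which measures the failure of
`verticalDeriv α v` to commute with the total derivative `D_k`. -/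
def translate (k : Fin 3) (v : MultiIndex → ℝ) : MultiIndex → ℝ := fun J => v (J + unitIndex k)

section LineDerivOnJets

variable {M : Set Total} {h : Total → ℝ} {P Q : Jet → ℝ} {z : Jet}

theorem eventually_proj_mem (hM : IsOpen M) (hz : proj z ∈ M) (v : Jet) :
    ∀ᶠ t : ℝ in nhds 0, proj (z + t • v) ∈ M := by
  have hcont : Continuous fun t : ℝ => proj z + t • proj v := by fun_prop
  exact hcont.continuousAt.eventually_mem (hM.mem_nhds (by simpa using hz))

theorem lineDeriv_eq_of_eqOn (hM : IsOpen M) (hPQ : Set.EqOn P Q (proj ⁻¹' M))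
    (hz : proj z ∈ M) (v : Jet) : lineDeriv ℝ P z v = lineDeriv ℝ Q z v :=
  Filter.EventuallyEq.deriv_eq ((eventually_proj_mem hM hz v).mono fun _ ht => hPQ ht)

theorem hasLineDerivAt_comp_proj (hh : DifferentiableAt ℝ h (proj z)) (v : Jet) :
    HasLineDerivAt ℝ (h ∘ proj) (fderiv ℝ h (proj z) (proj v)) z v :=
  hh.hasFDerivAt.hasLineDerivAt (proj v)

theorem hasLineDerivAt_jetCoord (α : Fin 2) (J : MultiIndex) (v : Jet) :
    HasLineDerivAt ℝ (jetCoord α J) (v.2 α J) z v := by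
  simpa [HasLineDerivAt, jetCoord] using
    ((hasDerivAt_id (0 : ℝ)).mul_const (v.2 α J)).const_add (z.2 α J)

end LineDerivOnJets

section DifferentialFunctions

variable {M : Set Total} {h : Total → ℝ} {P Q : Jet → ℝ}

theorem totalDeriv_jetCoord (k : Fin 3) (α : Fin 2) (J : MultiIndex) :
    totalDeriv k (jetCoord α J) = jetCoord α (J + unitIndex k) :=
  funext fun _ => (hasLineDerivAt_jetCoord α J _).lineDeriv

theorem verticalDeriv_jetCoord (α : Fin 2) (v : MultiIndex → ℝ) (β : Fin 2) (J : MultiIndex) :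
    verticalDeriv α v (jetCoord β J) = fun _ => (Pi.single α v : Fin 2 → MultiIndex → ℝ) β J :=
  funext fun _ => (hasLineDerivAt_jetCoord β J _).lineDeriv

theorem totalDeriv_const (k : Fin 3) (c : ℝ) : totalDeriv k (fun _ => c) = 0 :=
  funext fun _ => deriv_const 0 c

theorem verticalDeriv_const (α : Fin 2) (v : MultiIndex → ℝ) (c : ℝ) :
    verticalDeriv α v (fun _ => c) = 0 :=
  funext fun _ => deriv_const 0 c

theorem totalDeriv_eqOn (hM : IsOpen M) (hPQ : Set.EqOn P Q (proj ⁻¹' M)) (k : Fin 3) :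
    Set.EqOn (totalDeriv k P) (totalDeriv k Q) (proj ⁻¹' M) :=
  fun _ hz => lineDeriv_eq_of_eqOn hM hPQ hz _

theorem verticalDeriv_eqOn (hM : IsOpen M) (hPQ : Set.EqOn P Q (proj ⁻¹' M)) (α : Fin 2)
    (v : MultiIndex → ℝ) :
    Set.EqOn (verticalDeriv α v P) (verticalDeriv α v Q) (proj ⁻¹' M) :=
  fun _ hz => lineDeriv_eq_of_eqOn hM hPQ hz _

theorem totalDeriv_comp_proj (hM : IsOpen M) (hh : ContDiffOn ℝ ∞ h M) (k : Fin 3) :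
    Set.EqOn (totalDeriv k (h ∘ proj)) (baseDeriv k h ∘ proj
      + (jetCoord 0 (unitIndex k) * (fibreDeriv 0 h ∘ proj)
        + jetCoord 1 (unitIndex k) * (fibreDeriv 1 h ∘ proj))) (proj ⁻¹' M) := by
  intro z hz
  have hd := hasLineDerivAt_comp_proj (differentiableAt_of_contDiffOn hM hh hz) (shift k z)
  refine hd.lineDeriv.trans ?_
  rw [fderiv_total_apply]
  simp [proj, shift, jetCoord, Pi.single_apply]

theorem verticalDeriv_comp_proj (hM : IsOpen M) (hh : ContDiffOn ℝ ∞ h M) (α : Fin 2)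
    (v : MultiIndex → ℝ) :
    Set.EqOn (verticalDeriv α v (h ∘ proj)) (v 0 • (fibreDeriv α h ∘ proj)) (proj ⁻¹' M) := by
  intro z hz
  have hd := hasLineDerivAt_comp_proj (differentiableAt_of_contDiffOn hM hh hz)
    (0, Pi.single α v)
  refine hd.lineDeriv.trans ?_
  rw [fderiv_total_apply]
  fin_cases α <;> simp [proj]

namespace IsDifferentialFunction

theorem lineDifferentiableAt (hM : IsOpen M) (hP : IsDifferentialFunction M P) {z : Jet}
    (hz : proj z ∈ M) (v : Jet) : LineDifferentiableAt ℝ P z v := by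
  induction hP with
  | comp_proj hh =>
    have hd := differentiableAt_of_contDiffOn hM hh hz
    exact (hasLineDerivAt_comp_proj hd v).lineDifferentiableAt
  | coord α J => exact (hasLineDerivAt_jetCoord α J v).lineDifferentiableAt
  | add _ _ ihP ihQ => exact DifferentiableAt.add ihP ihQ
  | mul _ _ ihP ihQ => exact DifferentiableAt.mul ihP ihQ
  | congr _ hPQ ih =>
    exact DifferentiableAt.congr_of_eventuallyEq ih
      ((eventually_proj_mem hM hz v).mono fun _ ht => (hPQ ht).symm)

theorem const (c : ℝ) : IsDifferentialFunction M fun _ => c :=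
  comp_proj (h := fun _ => c) contDiffOn_const

theorem const_smul (hP : IsDifferentialFunction M P) (c : ℝ) : IsDifferentialFunction M (c • P) :=
  (const c).mul hP

theorem sub (hP : IsDifferentialFunction M P) (hQ : IsDifferentialFunction M Q) :
    IsDifferentialFunction M (P - Q) :=
  (hP.add (hQ.const_smul (-1))).congr fun z _ => by simp [sub_eq_add_neg]

theorem totalDeriv_add (hM : IsOpen M) (hP : IsDifferentialFunction M P)
    (hQ : IsDifferentialFunction M Q) (k : Fin 3) :
    Set.EqOn (totalDeriv k (P + Q)) (totalDeriv k P + totalDeriv k Q) (proj ⁻¹' M) :=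
  fun _ hz => lineDeriv_add (hP.lineDifferentiableAt hM hz _) (hQ.lineDifferentiableAt hM hz _)

theorem totalDeriv_mul (hM : IsOpen M) (hP : IsDifferentialFunction M P)
    (hQ : IsDifferentialFunction M Q) (k : Fin 3) :
    Set.EqOn (totalDeriv k (P * Q)) (totalDeriv k P * Q + P * totalDeriv k Q) (proj ⁻¹' M) :=
  fun _ hz => lineDeriv_mul (hP.lineDifferentiableAt hM hz _) (hQ.lineDifferentiableAt hM hz _)

theorem verticalDeriv_add (hM : IsOpen M) (hP : IsDifferentialFunction M P)
    (hQ : IsDifferentialFunction M Q) (α : Fin 2) (v : MultiIndex → ℝ) :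
    Set.EqOn (verticalDeriv α v (P + Q)) (verticalDeriv α v P + verticalDeriv α v Q)
      (proj ⁻¹' M) :=
  fun _ hz => lineDeriv_add (hP.lineDifferentiableAt hM hz _) (hQ.lineDifferentiableAt hM hz _)

theorem verticalDeriv_mul (hM : IsOpen M) (hP : IsDifferentialFunction M P)
    (hQ : IsDifferentialFunction M Q) (α : Fin 2) (v : MultiIndex → ℝ) :
    Set.EqOn (verticalDeriv α v (P * Q)) (verticalDeriv α v P * Q + P * verticalDeriv α v Q)
      (proj ⁻¹' M) :=
  fun _ hz => lineDeriv_mul (hP.lineDifferentiableAt hM hz _) (hQ.lineDifferentiableAt hM hz _)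

theorem totalDeriv_const_smul (hM : IsOpen M) (hP : IsDifferentialFunction M P) (c : ℝ)
    (k : Fin 3) : Set.EqOn (totalDeriv k (c • P)) (c • totalDeriv k P) (proj ⁻¹' M) := by
  intro z hz
  have h := (const (M := M) c).totalDeriv_mul hM hP k hz
  rw [totalDeriv_const, zero_mul, zero_add] at h
  exact h

protected theorem totalDeriv (hM : IsOpen M) (hP : IsDifferentialFunction M P) (k : Fin 3) :
    IsDifferentialFunction M (totalDeriv k P) := by
  induction hP with
  | comp_proj hh =>
    exact ((comp_proj (contDiffOn_baseDeriv hM hh k)).add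
      (((coord 0 _).mul (comp_proj (contDiffOn_fibreDeriv hM hh 0))).add
        ((coord 1 _).mul (comp_proj (contDiffOn_fibreDeriv hM hh 1))))).congr
      (totalDeriv_comp_proj hM hh k).symm
  | coord α J => exact totalDeriv_jetCoord k α J ▸ coord α _
  | add hP hQ ihP ihQ => exact (ihP.add ihQ).congr (totalDeriv_add hM hP hQ k).symm
  | mul hP hQ ihP ihQ =>
    exact ((ihP.mul hQ).add (hP.mul ihQ)).congr (totalDeriv_mul hM hP hQ k).symm
  | congr _ hPQ ih => exact ih.congr (totalDeriv_eqOn hM hPQ k)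

protected theorem verticalDeriv (hM : IsOpen M) (hP : IsDifferentialFunction M P) (α : Fin 2)
    (v : MultiIndex → ℝ) : IsDifferentialFunction M (verticalDeriv α v P) := by
  induction hP with
  | comp_proj hh =>
    exact ((comp_proj (contDiffOn_fibreDeriv hM hh α)).const_smul (v 0)).congr
      (verticalDeriv_comp_proj hM hh α v).symm
  | coord β J => exact verticalDeriv_jetCoord α v β J ▸ const _
  | add hP hQ ihP ihQ => exact (ihP.add ihQ).congr (verticalDeriv_add hM hP hQ α v).symm
  | mul hP hQ ihP ihQ =>
    exact ((ihP.mul hQ).add (hP.mul ihQ)).congr (verticalDeriv_mul hM hP hQ α v).symm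
  | congr _ hPQ ih => exact ih.congr (verticalDeriv_eqOn hM hPQ α v)

end IsDifferentialFunction

end DifferentialFunctions

section Commutators

variable {M : Set Total} {h : Total → ℝ} {P : Jet → ℝ}

theorem totalDeriv_totalDeriv_comp_proj (hM : IsOpen M) (hh : ContDiffOn ℝ ∞ h M) (k l : Fin 3) :
    Set.EqOn (totalDeriv l (totalDeriv k (h ∘ proj)))
      (totalDeriv l (baseDeriv k h ∘ proj)
        + ((jetCoord 0 (unitIndex k + unitIndex l) * (fibreDeriv 0 h ∘ proj)
          + jetCoord 0 (unitIndex k) * totalDeriv l (fibreDeriv 0 h ∘ proj))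
        + (jetCoord 1 (unitIndex k + unitIndex l) * (fibreDeriv 1 h ∘ proj)
          + jetCoord 1 (unitIndex k) * totalDeriv l (fibreDeriv 1 h ∘ proj)))) (proj ⁻¹' M) := by
  have hb := IsDifferentialFunction.comp_proj (contDiffOn_baseDeriv hM hh k)
  have hu := fun α => IsDifferentialFunction.coord (M := M) α (unitIndex k)
  have hf := fun α => IsDifferentialFunction.comp_proj (contDiffOn_fibreDeriv hM hh α)
  intro z hz
  rw [totalDeriv_eqOn hM (totalDeriv_comp_proj hM hh k) l hz,
    hb.totalDeriv_add hM (((hu 0).mul (hf 0)).add ((hu 1).mul (hf 1))) l hz, Pi.add_apply,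
    ((hu 0).mul (hf 0)).totalDeriv_add hM ((hu 1).mul (hf 1)) l hz, Pi.add_apply,
    (hu 0).totalDeriv_mul hM (hf 0) l hz, (hu 1).totalDeriv_mul hM (hf 1) l hz]
  simp only [totalDeriv_jetCoord, Pi.add_apply]

theorem verticalDeriv_totalDeriv_comp_proj (hM : IsOpen M) (hh : ContDiffOn ℝ ∞ h M)
    (α : Fin 2) (k : Fin 3) (v : MultiIndex → ℝ) :
    Set.EqOn (verticalDeriv α v (totalDeriv k (h ∘ proj)))
      (v 0 • totalDeriv k (fibreDeriv α h ∘ proj) + v (unitIndex k) • (fibreDeriv α h ∘ proj))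
      (proj ⁻¹' M) := by
  have hb := contDiffOn_baseDeriv hM hh k
  have hf := contDiffOn_fibreDeriv hM hh
  have hb' := IsDifferentialFunction.comp_proj hb
  have hu' := fun β => IsDifferentialFunction.coord (M := M) β (unitIndex k)
  have hf' := fun β => IsDifferentialFunction.comp_proj (hf β)
  intro z hz
  have hbf : fibreDeriv α (baseDeriv k h) (proj z) = baseDeriv k (fibreDeriv α h) (proj z) :=
    lieDeriv_const_comm hM hh _ _ hz
  have hff (β : Fin 2) :
      fibreDeriv α (fibreDeriv β h) (proj z) = fibreDeriv β (fibreDeriv α h) (proj z) :=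
    lieDeriv_const_comm hM hh _ _ hz
  rw [verticalDeriv_eqOn hM (totalDeriv_comp_proj hM hh k) α v hz,
    hb'.verticalDeriv_add hM (((hu' 0).mul (hf' 0)).add ((hu' 1).mul (hf' 1))) α v hz,
    Pi.add_apply, ((hu' 0).mul (hf' 0)).verticalDeriv_add hM ((hu' 1).mul (hf' 1)) α v hz,
    Pi.add_apply, (hu' 0).verticalDeriv_mul hM (hf' 0) α v hz,
    (hu' 1).verticalDeriv_mul hM (hf' 1) α v hz]
  simp only [verticalDeriv_jetCoord, verticalDeriv_comp_proj hM hb α v hz,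
    verticalDeriv_comp_proj hM (hf _) α v hz, totalDeriv_comp_proj hM (hf α) k hz, hbf, hff,
    Pi.add_apply, Pi.mul_apply, Pi.smul_apply, Function.comp_apply, smul_eq_mul]
  fin_cases α <;> simp <;> ring

namespace IsDifferentialFunction

theorem totalDeriv_comm (hM : IsOpen M) (hP : IsDifferentialFunction M P) (k l : Fin 3) :
    Set.EqOn (totalDeriv l (totalDeriv k P)) (totalDeriv k (totalDeriv l P)) (proj ⁻¹' M) := by
  induction hP with
  | @comp_proj h hh =>
    intro z hz
    have hb := contDiffOn_baseDeriv hM hh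
    have hf := contDiffOn_fibreDeriv hM hh
    have hbb : baseDeriv l (baseDeriv k h) (proj z) = baseDeriv k (baseDeriv l h) (proj z) :=
      lieDeriv_const_comm hM hh _ _ hz
    have hbf (k : Fin 3) (α : Fin 2) :
        baseDeriv k (fibreDeriv α h) (proj z) = fibreDeriv α (baseDeriv k h) (proj z) :=
      lieDeriv_const_comm hM hh _ _ hz
    have hff : fibreDeriv 0 (fibreDeriv 1 h) (proj z) = fibreDeriv 1 (fibreDeriv 0 h) (proj z) :=
      lieDeriv_const_comm hM hh _ _ hz
    simp only [totalDeriv_totalDeriv_comp_proj hM hh _ _ hz, totalDeriv_comp_proj hM (hb _) _ hz,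
      totalDeriv_comp_proj hM (hf _) _ hz, hbb, hbf, hff, Pi.add_apply, Pi.mul_apply,
      Function.comp_apply, add_comm (unitIndex l)]
    ring
  | coord α J => simp [Set.EqOn, totalDeriv_jetCoord, add_right_comm]
  | add hP hQ ihP ihQ =>
    intro z hz
    simp only [totalDeriv_eqOn hM (hP.totalDeriv_add hM hQ _) _ hz,
      (hP.totalDeriv hM _).totalDeriv_add hM (hQ.totalDeriv hM _) _ hz, Pi.add_apply,
      ihP hz, ihQ hz]
  | mul hP hQ ihP ihQ =>
    intro z hz
    simp only [totalDeriv_eqOn hM (hP.totalDeriv_mul hM hQ _) _ hz,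
      ((hP.totalDeriv hM _).mul hQ).totalDeriv_add hM (hP.mul (hQ.totalDeriv hM _)) _ hz,
      (hP.totalDeriv hM _).totalDeriv_mul hM hQ _ hz,
      hP.totalDeriv_mul hM (hQ.totalDeriv hM _) _ hz, Pi.add_apply, Pi.mul_apply, ihP hz, ihQ hz]
    ring
  | congr _ hPQ ih =>
    exact ((totalDeriv_eqOn hM (totalDeriv_eqOn hM hPQ k) l).symm.trans ih).trans
      (totalDeriv_eqOn hM (totalDeriv_eqOn hM hPQ l) k)

theorem verticalDeriv_totalDeriv (hM : IsOpen M) (hP : IsDifferentialFunction M P) (α : Fin 2)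
    (k : Fin 3) (v : MultiIndex → ℝ) :
    Set.EqOn (verticalDeriv α v (totalDeriv k P))
      (totalDeriv k (verticalDeriv α v P) + verticalDeriv α (translate k v) P) (proj ⁻¹' M) := by
  induction hP with
  | @comp_proj h hh =>
    intro z hz
    have hf := comp_proj (contDiffOn_fibreDeriv hM hh α)
    rw [verticalDeriv_totalDeriv_comp_proj hM hh α k v hz, Pi.add_apply, Pi.add_apply,
      totalDeriv_eqOn hM (verticalDeriv_comp_proj hM hh α v) k hz,
      hf.totalDeriv_const_smul hM (v 0) k hz, verticalDeriv_comp_proj hM hh α _ hz]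
    simp only [translate, zero_add]
  | coord β J =>
    intro z _
    simp only [totalDeriv_jetCoord, verticalDeriv_jetCoord, totalDeriv_const, Pi.add_apply,
      Pi.zero_apply, zero_add]
    rcases eq_or_ne β α with rfl | hβ <;> simp [*, translate]
  | add hP hQ ihP ihQ =>
    intro z hz
    simp only [verticalDeriv_eqOn hM (hP.totalDeriv_add hM hQ k) _ _ hz,
      totalDeriv_eqOn hM (hP.verticalDeriv_add hM hQ _ _) _ hz,
      (hP.totalDeriv hM _).verticalDeriv_add hM (hQ.totalDeriv hM _) _ _ hz,
      (hP.verticalDeriv hM _ _).totalDeriv_add hM (hQ.verticalDeriv hM _ _) _ hz,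
      hP.verticalDeriv_add hM hQ _ _ hz, Pi.add_apply, ihP hz, ihQ hz]
    ring
  | mul hP hQ ihP ihQ =>
    intro z hz
    simp only [verticalDeriv_eqOn hM (hP.totalDeriv_mul hM hQ k) _ _ hz,
      totalDeriv_eqOn hM (hP.verticalDeriv_mul hM hQ _ _) _ hz,
      ((hP.totalDeriv hM _).mul hQ).verticalDeriv_add hM (hP.mul (hQ.totalDeriv hM _)) _ _ hz,
      ((hP.verticalDeriv hM _ _).mul hQ).totalDeriv_add hM (hP.mul (hQ.verticalDeriv hM _ _)) _ hz,
      (hP.totalDeriv hM _).verticalDeriv_mul hM hQ _ _ hz,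
      hP.verticalDeriv_mul hM (hQ.totalDeriv hM _) _ _ hz,
      (hP.verticalDeriv hM _ _).totalDeriv_mul hM hQ _ hz,
      hP.totalDeriv_mul hM (hQ.verticalDeriv hM _ _) _ hz,
      hP.verticalDeriv_mul hM hQ _ _ hz, Pi.add_apply, Pi.mul_apply, ihP hz, ihQ hz]
    ring
  | congr _ hPQ ih =>
    exact ((verticalDeriv_eqOn hM (totalDeriv_eqOn hM hPQ k) α v).symm.trans ih).trans
      fun z hz => congrArg₂ (· + ·) (totalDeriv_eqOn hM (verticalDeriv_eqOn hM hPQ α v) k hz)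
        (verticalDeriv_eqOn hM hPQ α _ hz)

end IsDifferentialFunction

section VerticalExpansion

variable (hM : IsOpen M) (hh : ContDiffOn ℝ ∞ h M) (α : Fin 2) (v : MultiIndex → ℝ)
include hM hh

theorem verticalDeriv_totalDeriv_totalDeriv_comp_proj (k l : Fin 3) :
    Set.EqOn (verticalDeriv α v (totalDeriv l (totalDeriv k (h ∘ proj))))
      (v 0 • totalDeriv l (totalDeriv k (fibreDeriv α h ∘ proj))
        + v (unitIndex k) • totalDeriv l (fibreDeriv α h ∘ proj)
        + v (unitIndex l) • totalDeriv k (fibreDeriv α h ∘ proj)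
        + v (unitIndex k + unitIndex l) • (fibreDeriv α h ∘ proj)) (proj ⁻¹' M) := by
  have hP := IsDifferentialFunction.comp_proj hh
  have hg := IsDifferentialFunction.comp_proj (contDiffOn_fibreDeriv hM hh α)
  have hDg := hg.totalDeriv hM k
  intro z hz
  rw [(hP.totalDeriv hM k).verticalDeriv_totalDeriv hM α l v hz, Pi.add_apply,
    totalDeriv_eqOn hM (verticalDeriv_totalDeriv_comp_proj hM hh α k v) l hz,
    (hDg.const_smul _).totalDeriv_add hM (hg.const_smul _) l hz, Pi.add_apply,
    hDg.totalDeriv_const_smul hM _ l hz, hg.totalDeriv_const_smul hM _ l hz,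
    verticalDeriv_totalDeriv_comp_proj hM hh α k _ hz]
  simp only [translate, zero_add, Pi.add_apply]
  ring

theorem verticalDeriv_totalDeriv_totalDeriv_totalDeriv_comp_proj (k l m : Fin 3) :
    Set.EqOn (verticalDeriv α v (totalDeriv m (totalDeriv l (totalDeriv k (h ∘ proj)))))
      (v 0 • totalDeriv m (totalDeriv l (totalDeriv k (fibreDeriv α h ∘ proj)))
        + v (unitIndex k) • totalDeriv m (totalDeriv l (fibreDeriv α h ∘ proj))
        + v (unitIndex l) • totalDeriv m (totalDeriv k (fibreDeriv α h ∘ proj))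
        + v (unitIndex m) • totalDeriv l (totalDeriv k (fibreDeriv α h ∘ proj))
        + v (unitIndex k + unitIndex l) • totalDeriv m (fibreDeriv α h ∘ proj)
        + v (unitIndex k + unitIndex m) • totalDeriv l (fibreDeriv α h ∘ proj)
        + v (unitIndex l + unitIndex m) • totalDeriv k (fibreDeriv α h ∘ proj)
        + v (unitIndex k + unitIndex l + unitIndex m) • (fibreDeriv α h ∘ proj))
      (proj ⁻¹' M) := by
  have hP := IsDifferentialFunction.comp_proj hh
  have hg := IsDifferentialFunction.comp_proj (contDiffOn_fibreDeriv hM hh α)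
  have hDg := fun k => hg.totalDeriv hM k
  have hDDg := (hDg k).totalDeriv hM l
  intro z hz
  rw [((hP.totalDeriv hM k).totalDeriv hM l).verticalDeriv_totalDeriv hM α m v hz, Pi.add_apply,
    totalDeriv_eqOn hM (verticalDeriv_totalDeriv_totalDeriv_comp_proj hM hh α v k l) m hz,
    (((hDDg.const_smul _).add ((hDg l).const_smul _)).add
      ((hDg k).const_smul _)).totalDeriv_add hM (hg.const_smul _) m hz, Pi.add_apply,
    ((hDDg.const_smul _).add ((hDg l).const_smul _)).totalDeriv_add hM
      ((hDg k).const_smul _) m hz, Pi.add_apply,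
    (hDDg.const_smul _).totalDeriv_add hM ((hDg l).const_smul _) m hz, Pi.add_apply,
    hDDg.totalDeriv_const_smul hM _ m hz, (hDg l).totalDeriv_const_smul hM _ m hz,
    (hDg k).totalDeriv_const_smul hM _ m hz, hg.totalDeriv_const_smul hM _ m hz,
    verticalDeriv_totalDeriv_totalDeriv_comp_proj hM hh α _ k l hz]
  simp only [translate, zero_add, Pi.add_apply]
  ring

end VerticalExpansion

end Commutators

section ViscoelasticOperator

/-- The operator `P ↦ D_t² P - ε (D_x² + D_y²) D_t P - γ (D_x² + D_y²) P` on functions on the jet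
space. -/
def totalViscoOp (ε γ : ℝ) (P : Jet → ℝ) : Jet → ℝ :=
  𝐃 2 (𝐃 2 P) - ε • (𝐃 0 (𝐃 0 (𝐃 2 P)) + 𝐃 1 (𝐃 1 (𝐃 2 P))) - γ • (𝐃 0 (𝐃 0 P) + 𝐃 1 (𝐃 1 P))

/-- The bilinear form `L (P Q) - L P * Q - P * L Q` in `P` and `Q`, where `L` is the operator
`totalViscoOp ε γ`. -/
def viscoCross (ε γ : ℝ) (P Q : Jet → ℝ) : Jet → ℝ :=
  2 * (𝐃 2 P * 𝐃 2 Q)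
    - ε • ((𝐃 0 (𝐃 0 P) + 𝐃 1 (𝐃 1 P)) * 𝐃 2 Q + 𝐃 2 P * (𝐃 0 (𝐃 0 Q) + 𝐃 1 (𝐃 1 Q))
      + 2 * (𝐃 0 (𝐃 2 P) * 𝐃 0 Q + 𝐃 0 P * 𝐃 0 (𝐃 2 Q)
        + 𝐃 1 (𝐃 2 P) * 𝐃 1 Q + 𝐃 1 P * 𝐃 1 (𝐃 2 Q)))
    - γ • (2 * (𝐃 0 P * 𝐃 0 Q + 𝐃 1 P * 𝐃 1 Q))

variable {M : Set Total} {P Q : Jet → ℝ}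

theorem totalViscoOp_eqOn (hM : IsOpen M) (hPQ : Set.EqOn P Q (proj ⁻¹' M)) (ε γ : ℝ) :
    Set.EqOn (totalViscoOp ε γ P) (totalViscoOp ε γ Q) (proj ⁻¹' M) := by
  have hD := fun k => totalDeriv_eqOn hM hPQ k
  have hDD := fun k l => totalDeriv_eqOn hM (hD k) l
  have hDDD := fun k l => totalDeriv_eqOn hM (hDD k l) l
  intro z hz
  simp only [totalViscoOp, Pi.sub_apply, Pi.add_apply, Pi.smul_apply, hDD _ _ hz, hDDD _ _ hz]

namespace IsDifferentialFunction

theorem totalDeriv_totalDeriv_add (hM : IsOpen M) (hP : IsDifferentialFunction M P)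
    (hQ : IsDifferentialFunction M Q) (k l : Fin 3) :
    Set.EqOn (𝐃 l (𝐃 k (P + Q))) (𝐃 l (𝐃 k P) + 𝐃 l (𝐃 k Q)) (proj ⁻¹' M) :=
  (totalDeriv_eqOn hM (hP.totalDeriv_add hM hQ k) l).trans
    ((hP.totalDeriv hM k).totalDeriv_add hM (hQ.totalDeriv hM k) l)

theorem totalDeriv_totalDeriv_mul (hM : IsOpen M) (hP : IsDifferentialFunction M P)
    (hQ : IsDifferentialFunction M Q) (k : Fin 3) :
    Set.EqOn (𝐃 k (𝐃 k (P * Q)))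
      (𝐃 k (𝐃 k P) * Q + 2 * (𝐃 k P * 𝐃 k Q) + P * 𝐃 k (𝐃 k Q)) (proj ⁻¹' M) := by
  have hP' := hP.totalDeriv hM k
  have hQ' := hQ.totalDeriv hM k
  intro z hz
  rw [totalDeriv_eqOn hM (hP.totalDeriv_mul hM hQ k) k hz,
    (hP'.mul hQ).totalDeriv_add hM (hP.mul hQ') k hz, Pi.add_apply,
    hP'.totalDeriv_mul hM hQ k hz, hP.totalDeriv_mul hM hQ' k hz]
  simp only [Pi.add_apply, Pi.mul_apply, Pi.ofNat_apply]
  ring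

theorem totalViscoOp_add (hM : IsOpen M) (hP : IsDifferentialFunction M P)
    (hQ : IsDifferentialFunction M Q) (ε γ : ℝ) :
    Set.EqOn (totalViscoOp ε γ (P + Q)) (totalViscoOp ε γ P + totalViscoOp ε γ Q)
      (proj ⁻¹' M) := by
  have hDD := fun k => hP.totalDeriv_totalDeriv_add hM hQ k k
  have hDDD (k : Fin 3) := (totalDeriv_eqOn hM
    (totalDeriv_eqOn hM (hP.totalDeriv_add hM hQ 2) k) k).trans
      ((hP.totalDeriv hM 2).totalDeriv_totalDeriv_add hM (hQ.totalDeriv hM 2) k k)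
  intro z hz
  simp only [totalViscoOp, Pi.sub_apply, Pi.add_apply, Pi.smul_apply, smul_eq_mul, hDD _ hz,
    hDDD _ hz]
  ring

theorem totalViscoOp_mul (hM : IsOpen M) (hP : IsDifferentialFunction M P)
    (hQ : IsDifferentialFunction M Q) (ε γ : ℝ) :
    Set.EqOn (totalViscoOp ε γ (P * Q))
      (totalViscoOp ε γ P * Q + viscoCross ε γ P Q + P * totalViscoOp ε γ Q) (proj ⁻¹' M) := by
  have hP' := hP.totalDeriv hM 2
  have hQ' := hQ.totalDeriv hM 2
  have hDD := fun k => hP.totalDeriv_totalDeriv_mul hM hQ k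
  have hDDD (k : Fin 3) := (totalDeriv_eqOn hM (totalDeriv_eqOn hM (hP.totalDeriv_mul hM hQ 2) k)
    k).trans ((hP'.mul hQ).totalDeriv_totalDeriv_add hM (hP.mul hQ') k k)
  intro z hz
  simp only [totalViscoOp, viscoCross, Pi.sub_apply, Pi.add_apply, Pi.smul_apply, Pi.mul_apply,
    Pi.ofNat_apply, smul_eq_mul, hDD _ hz, hDDD _ hz, hP'.totalDeriv_totalDeriv_mul hM hQ _ hz,
    hP.totalDeriv_totalDeriv_mul hM hQ' _ hz]
  ring

theorem totalViscoOp_const_smul (hM : IsOpen M) (hP : IsDifferentialFunction M P) (ε γ c : ℝ) :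
    Set.EqOn (totalViscoOp ε γ (c • P)) (c • totalViscoOp ε γ P) (proj ⁻¹' M) := by
  have hzero (k : Fin 3) : 𝐃 k (0 : Jet → ℝ) = 0 := totalDeriv_const k 0
  intro z hz
  have h := (const (M := M) c).totalViscoOp_mul hM hP ε γ hz
  simp only [totalViscoOp, viscoCross, totalDeriv_const, hzero] at h ⊢
  exact h.trans (by simp)

protected theorem totalViscoOp (hM : IsOpen M) (hP : IsDifferentialFunction M P) (ε γ : ℝ) :
    IsDifferentialFunction M (totalViscoOp ε γ P) := by
  have hD {Q : Jet → ℝ} (hQ : IsDifferentialFunction M Q) (k : Fin 3) :=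
    (hQ.totalDeriv hM k).totalDeriv hM k
  have hP' := hP.totalDeriv hM 2
  exact ((hD hP 2).sub (((hD hP' 0).add (hD hP' 1)).const_smul ε)).sub
    (((hD hP 0).add (hD hP 1)).const_smul γ)

end IsDifferentialFunction

end ViscoelasticOperator

section Prolongation

/-- The coefficient `ξ^i` of a vector field on the total space. -/
def baseCoeff (V : Total → Total) (i : Fin 3) : Total → ℝ := fun p => (V p).1 i

/-- The coefficient `φ_α` of a vector field on the total space. -/
def fibreCoeff (V : Total → Total) (α : Fin 2) : Total → ℝ := fun p => (V p).2 α

variable {M : Set Total} {V : Total → Total} {ε γ : ℝ} {z : Jet}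

theorem contDiffOn_baseCoeff (hV : ContDiffOn ℝ ∞ V M) (i : Fin 3) :
    ContDiffOn ℝ ∞ (baseCoeff V i) M := contDiffOn_pi.1 hV.fst i

theorem contDiffOn_fibreCoeff (hV : ContDiffOn ℝ ∞ V M) (α : Fin 2) :
    ContDiffOn ℝ ∞ (fibreCoeff V α) M := contDiffOn_pi.1 hV.snd α

theorem equation_add_smul (ε γ t : ℝ) (z v : Jet) :
    equation ε γ (z + t • v) = equation ε γ z + t * equation ε γ v := by
  simp only [equation, Prod.snd_add, Prod.smul_snd, Pi.add_apply, Pi.smul_apply, smul_eq_mul]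
  ring

theorem lineDeriv_equation (ε γ : ℝ) (z v : Jet) :
    lineDeriv ℝ (equation ε γ) z v = equation ε γ v := by
  simp only [lineDeriv, equation_add_smul]
  simp

theorem totalViscoOp_jetCoord (ε γ : ℝ) (α : Fin 2) (J : MultiIndex) (z : Jet) :
    totalViscoOp ε γ (jetCoord α J) z = z.2 α (![0, 0, 2] + J)
      - ε * (z.2 α (![2, 0, 1] + J) + z.2 α (![0, 2, 1] + J))
      - γ * (z.2 α (![2, 0, 0] + J) + z.2 α (![0, 2, 0] + J)) := by
  have htt : unitIndex 2 + unitIndex 2 = ![0, 0, 2] := by decide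
  have hxxt : unitIndex 2 + ![2, 0, 0] = ![2, 0, 1] := by decide
  have hyyt : unitIndex 2 + ![0, 2, 0] = ![0, 2, 1] := by decide
  have hxx : unitIndex 0 + unitIndex 0 = ![2, 0, 0] := by decide
  have hyy : unitIndex 1 + unitIndex 1 = ![0, 2, 0] := by decide
  simp only [totalViscoOp, totalDeriv_jetCoord, Pi.sub_apply, Pi.add_apply, Pi.smul_apply,
    smul_eq_mul, add_assoc, htt, hxxt, hyyt, hxx, hyy]
  simp only [jetCoord, add_comm J]

theorem equation_eq (ε γ : ℝ) :
    equation ε γ = totalViscoOp ε γ (jetCoord 0 0) - jetCoord 1 0 := by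
  ext z
  simp only [equation, Pi.sub_apply, totalViscoOp_jetCoord, add_zero, jetCoord]

theorem isDifferentialFunction_characteristic (hV : ContDiffOn ℝ ∞ V M) (α : Fin 2) :
    IsDifferentialFunction M (characteristic V α) := by
  have hξu := fun i => (IsDifferentialFunction.comp_proj (contDiffOn_baseCoeff hV i)).mul
    (.coord α (unitIndex i))
  refine ((IsDifferentialFunction.comp_proj (contDiffOn_fibreCoeff hV α)).sub
    (((hξu 0).add (hξu 1)).add (hξu 2))).congr fun z _ => ?_
  simp only [characteristic, Fin.sum_univ_three]
  rfl

theorem prolongApply_equation_eq_characteristic (V : Total → Total) (ε γ : ℝ) (z : Jet) :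
    prolongApply V (equation ε γ) z
      = totalViscoOp ε γ (characteristic V 0) z - characteristic V 1 z
        + ∑ i, baseCoeff V i (proj z)
          * (totalViscoOp ε γ (jetCoord 0 (unitIndex i)) z - z.2 1 (unitIndex i)) := by
  rw [prolongApply, lineDeriv_equation]
  simp only [totalViscoOp_jetCoord, Fin.sum_univ_three]
  simp only [equation, prolong, prolongCoeff, Fin.sum_univ_three, zero_add]
  change (𝐃 2 (𝐃 2 (characteristic V 0)) z + _) - ε * ((𝐃 0 (𝐃 0 (𝐃 2 _)) z + _)
    + (𝐃 1 (𝐃 1 (𝐃 2 _)) z + _)) - γ * ((𝐃 0 (𝐃 0 (characteristic V 0)) z + _)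
    + (𝐃 1 (𝐃 1 (characteristic V 0)) z + _)) - (characteristic V 1 z + _) = _
  simp only [totalViscoOp, baseCoeff, Pi.sub_apply, Pi.add_apply, Pi.smul_apply, smul_eq_mul]
  ring

/-- The terms `ξ^i L u_i` and `ξ^i f_i` of the characteristic cancel against the second summand
of `prolongCoeff`. -/
theorem prolongApply_equation (hM : IsOpen M) (hV : ContDiffOn ℝ ∞ V M) (ε γ : ℝ) :
    Set.EqOn (prolongApply V (equation ε γ))
      (totalViscoOp ε γ (fibreCoeff V 0 ∘ proj) - fibreCoeff V 1 ∘ proj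
        - ∑ i, (totalViscoOp ε γ (baseCoeff V i ∘ proj) * jetCoord 0 (unitIndex i)
          + viscoCross ε γ (baseCoeff V i ∘ proj) (jetCoord 0 (unitIndex i)))) (proj ⁻¹' M) := by
  have hQ := isDifferentialFunction_characteristic hV 0
  have hξ := fun i => IsDifferentialFunction.comp_proj (contDiffOn_baseCoeff hV i)
  have hu := fun i => IsDifferentialFunction.coord (M := M) 0 (unitIndex i)
  have hξu := fun i => (hξ i).mul (hu i)
  have hφ : fibreCoeff V 0 ∘ proj = characteristic V 0
      + (baseCoeff V 0 ∘ proj * jetCoord 0 (unitIndex 0)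
        + baseCoeff V 1 ∘ proj * jetCoord 0 (unitIndex 1)
        + baseCoeff V 2 ∘ proj * jetCoord 0 (unitIndex 2)) := by
    ext z
    simp [characteristic, fibreCoeff, baseCoeff, jetCoord, Fin.sum_univ_three]
  intro z hz
  rw [prolongApply_equation_eq_characteristic, hφ, Pi.sub_apply, Pi.sub_apply,
    hQ.totalViscoOp_add hM (((hξu 0).add (hξu 1)).add (hξu 2)) ε γ hz, Pi.add_apply,
    ((hξu 0).add (hξu 1)).totalViscoOp_add hM (hξu 2) ε γ hz, Pi.add_apply,
    (hξu 0).totalViscoOp_add hM (hξu 1) ε γ hz]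
  simp only [(hξ _).totalViscoOp_mul hM (hu _) ε γ hz, Fin.sum_univ_three, Finset.sum_apply,
    Pi.add_apply, Pi.mul_apply, characteristic, fibreCoeff, baseCoeff, Function.comp_apply]
  ring

end Prolongation

section VerticalDerivatives

variable {M : Set Total} {h : Total → ℝ} {P : Jet → ℝ} {z : Jet} {α : Fin 2}
  {v : MultiIndex → ℝ}

namespace IsDifferentialFunction

theorem hasLineDerivAt_verticalDeriv (hM : IsOpen M) (hP : IsDifferentialFunction M P)
    (hz : proj z ∈ M) (α : Fin 2) (v : MultiIndex → ℝ) :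
    HasLineDerivAt ℝ P (verticalDeriv α v P z) z (0, Pi.single α v) :=
  (hP.lineDifferentiableAt hM hz _).hasLineDerivAt

theorem hasLineDerivAt_mul_jetCoord (hM : IsOpen M) (hP : IsDifferentialFunction M P)
    (hz : proj z ∈ M) (hPv : verticalDeriv α v P z = 0) (β : Fin 2) (J : MultiIndex) :
    HasLineDerivAt ℝ (P * jetCoord β J) (P z * (Pi.single α v : Fin 2 → MultiIndex → ℝ) β J) z
      (0, Pi.single α v) := by
  have h := HasDerivAt.mul (hP.hasLineDerivAt_verticalDeriv hM hz α v)
    (hasLineDerivAt_jetCoord (z := z) β J (0, Pi.single α v))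
  exact h.congr_deriv (by simp [hPv])

theorem verticalDeriv_totalViscoOp (hM : IsOpen M) (hP : IsDifferentialFunction M P)
    (ε γ : ℝ) (α : Fin 2) (v : MultiIndex → ℝ) :
    Set.EqOn (verticalDeriv α v (totalViscoOp ε γ P))
      (verticalDeriv α v (𝐃 2 (𝐃 2 P))
        - ε • (verticalDeriv α v (𝐃 0 (𝐃 0 (𝐃 2 P))) + verticalDeriv α v (𝐃 1 (𝐃 1 (𝐃 2 P))))
        - γ • (verticalDeriv α v (𝐃 0 (𝐃 0 P)) + verticalDeriv α v (𝐃 1 (𝐃 1 P))))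
      (proj ⁻¹' M) := by
  intro z hz
  have hDD {Q : Jet → ℝ} (hQ : IsDifferentialFunction M Q) (k : Fin 3) :=
    ((hQ.totalDeriv hM k).totalDeriv hM k).hasLineDerivAt_verticalDeriv hM hz α v
  have hP' := hP.totalDeriv hM 2
  have hL := ((hDD hP 2).sub (((hDD hP' 0).add (hDD hP' 1)).const_mul ε)).sub
    (((hDD hP 0).add (hDD hP 1)).const_mul γ)
  exact HasLineDerivAt.lineDeriv hL

end IsDifferentialFunction

section ThirdOrder

variable (hM : IsOpen M) (hh : ContDiffOn ℝ ∞ h M) (hv : ∀ J, J 0 + J 1 + J 2 < 3 → v J = 0)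
include hM hh hv

theorem verticalDeriv_totalViscoOp_comp_proj_of_third_order (ε γ : ℝ) (α : Fin 2) :
    Set.EqOn (verticalDeriv α v (totalViscoOp ε γ (h ∘ proj)))
      ((-ε * (v (unitIndex 2 + unitIndex 0 + unitIndex 0)
        + v (unitIndex 2 + unitIndex 1 + unitIndex 1))) • (fibreDeriv α h ∘ proj))
      (proj ⁻¹' M) := by
  have hv₀ : v 0 = 0 := hv _ (by decide)
  have hv₁ (k : Fin 3) : v (unitIndex k) = 0 := hv _ (by revert k; decide)
  have hv₂ (k l : Fin 3) : v (unitIndex k + unitIndex l) = 0 := hv _ (by revert k l; decide)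
  intro z hz
  simp only [(IsDifferentialFunction.comp_proj hh).verticalDeriv_totalViscoOp hM ε γ α v hz,
    Pi.sub_apply, Pi.add_apply, Pi.smul_apply, smul_eq_mul, hv₀, hv₁, hv₂,
    verticalDeriv_totalDeriv_totalDeriv_comp_proj hM hh α v _ _ hz,
    verticalDeriv_totalDeriv_totalDeriv_totalDeriv_comp_proj hM hh α v _ _ _ hz]
  ring

theorem hasLineDerivAt_viscoCross_comp_proj_of_third_order (ε γ : ℝ) (α β : Fin 2)
    (i : Fin 3) (hz : proj z ∈ M)
    {w : MultiIndex → ℝ} (hw : w = (Pi.single α v : Fin 2 → MultiIndex → ℝ) β) :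
    HasLineDerivAt ℝ (viscoCross ε γ (h ∘ proj) (jetCoord β (unitIndex i)))
      (-ε * ((w (unitIndex i + unitIndex 0 + unitIndex 0)
          + w (unitIndex i + unitIndex 1 + unitIndex 1)) * 𝐃 2 (h ∘ proj) z
        + 2 * w (unitIndex i + unitIndex 2 + unitIndex 0) * 𝐃 0 (h ∘ proj) z
        + 2 * w (unitIndex i + unitIndex 2 + unitIndex 1) * 𝐃 1 (h ∘ proj) z))
      z (0, Pi.single α v) := by
  have hv₀ : v 0 = 0 := hv _ (by decide)
  have hv₁ (k : Fin 3) : v (unitIndex k) = 0 := hv _ (by revert k; decide)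
  have hv₂ (k l : Fin 3) : v (unitIndex k + unitIndex l) = 0 := hv _ (by revert k l; decide)
  have hw₂ (l : Fin 3) : w (unitIndex i + unitIndex l) = 0 := by
    rcases eq_or_ne β α with rfl | hβ <;> simp [*]
  have hDh := (IsDifferentialFunction.comp_proj hh).totalDeriv hM
  have hDv (k : Fin 3) : verticalDeriv α v (𝐃 k (h ∘ proj)) z = 0 := by
    simp [verticalDeriv_totalDeriv_comp_proj hM hh α k v hz, hv₀, hv₁]
  have hDDv (k l : Fin 3) : verticalDeriv α v (𝐃 l (𝐃 k (h ∘ proj))) z = 0 := by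
    simp [verticalDeriv_totalDeriv_totalDeriv_comp_proj hM hh α v k l hz, hv₀, hv₁, hv₂]
  have p (k : Fin 3) (J : MultiIndex) := (hDh k).hasLineDerivAt_mul_jetCoord hM hz (hDv k) β J
  have q (k l : Fin 3) (J : MultiIndex) :=
    ((hDh k).totalDeriv hM l).hasLineDerivAt_mul_jetCoord hM hz (hDDv k l) β J
  simp only [viscoCross, totalDeriv_jetCoord, add_mul, mul_add]
  refine HasDerivAt.congr_deriv (HasDerivAt.sub (HasDerivAt.sub ((p _ _).const_mul 2)
    (((((q _ _ _).add (q _ _ _)).add ((p _ _).add (p _ _))).add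
      (((((q _ _ _).const_mul 2).add ((p _ _).const_mul 2)).add ((q _ _ _).const_mul 2)).add
        ((p _ _).const_mul 2))).const_mul ε))
    ((((p _ _).const_mul 2).add ((p _ _).const_mul 2)).const_mul γ)) ?_
  simp only [← hw, hw₂]
  ring

end ThirdOrder

end VerticalDerivatives

/-- The differential consequences for the coefficients `ξ^i` of the third-order part of the
symmetry condition: `(ξ^0, ξ^1)` depends only on `(x, y)` and satisfies the Cauchy–Riemann type
equations of a planar conformal vector field, and `ξ^2` depends only on `t`. -/
structure IsBaseConformal (M : Set Total) (V : Total → Total) : Prop where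
  totalDeriv_time_zero : Set.EqOn (𝐃 2 (baseCoeff V 0 ∘ proj)) 0 (proj ⁻¹' M)
  totalDeriv_time_one : Set.EqOn (𝐃 2 (baseCoeff V 1 ∘ proj)) 0 (proj ⁻¹' M)
  totalDeriv_zero_time : Set.EqOn (𝐃 0 (baseCoeff V 2 ∘ proj)) 0 (proj ⁻¹' M)
  totalDeriv_one_time : Set.EqOn (𝐃 1 (baseCoeff V 2 ∘ proj)) 0 (proj ⁻¹' M)
  shear : Set.EqOn (𝐃 1 (baseCoeff V 0 ∘ proj)) (-𝐃 0 (baseCoeff V 1 ∘ proj)) (proj ⁻¹' M)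
  strain : Set.EqOn (𝐃 1 (baseCoeff V 1 ∘ proj)) (𝐃 0 (baseCoeff V 0 ∘ proj)) (proj ⁻¹' M)

section OnShell

variable {M : Set Total} {V : Total → Total} {h : Total → ℝ} {ε γ : ℝ} {z : Jet} {α : Fin 2}
  {v : MultiIndex → ℝ}

/-- The jet on the equation manifold that is obtained from `z` by changing the coordinate `u_tt`
alone. -/
def toShell (ε γ : ℝ) (z : Jet) : Jet :=
  z + (0, Pi.single 0 (Pi.single ![0, 0, 2] (-equation ε γ z)))

theorem toShell_apply_of_ne (ε γ : ℝ) (z : Jet) (α : Fin 2) {J : MultiIndex}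
    (hJ : J ≠ ![0, 0, 2]) : (toShell ε γ z).2 α J = z.2 α J := by
  fin_cases α <;> simp [toShell, hJ]

theorem proj_toShell (ε γ : ℝ) (z : Jet) : proj (toShell ε γ z) = proj z :=
  Prod.ext (add_zero z.1) (funext fun α => toShell_apply_of_ne ε γ z α (by decide))

theorem equation_toShell (ε γ : ℝ) (z : Jet) : equation ε γ (toShell ε γ z) = 0 := by
  have hne {J : MultiIndex} (hJ : J ≠ ![0, 0, 2]) (α : Fin 2) := toShell_apply_of_ne ε γ z α hJ
  have htt : (toShell ε γ z).2 0 ![0, 0, 2] = z.2 0 ![0, 0, 2] - equation ε γ z := by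
    simp [toShell, sub_eq_add_neg]
  rw [equation, htt, hne (by decide), hne (by decide), hne (by decide), hne (by decide),
    hne (by decide), equation]
  ring

theorem totalDeriv_comp_proj_toShell (hM : IsOpen M) (hh : ContDiffOn ℝ ∞ h M)
    (hz : proj z ∈ M) (ε γ : ℝ) (k : Fin 3) :
    𝐃 k (h ∘ proj) (toShell ε γ z) = 𝐃 k (h ∘ proj) z := by
  have hz' : proj (toShell ε γ z) ∈ M := (proj_toShell ε γ z).symm ▸ hz
  have hk (α : Fin 2) : (toShell ε γ z).2 α (unitIndex k) = z.2 α (unitIndex k) :=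
    toShell_apply_of_ne ε γ z α (by revert k; decide)
  simp only [totalDeriv_comp_proj hM hh k hz', totalDeriv_comp_proj hM hh k hz, Pi.add_apply,
    Pi.mul_apply, Function.comp_apply, proj_toShell, jetCoord, hk]

theorem IsInfinitesimalSymmetry.verticalDeriv_prolongApply (hM : IsOpen M)
    (hV : IsInfinitesimalSymmetry ε γ M V) (hz : proj z ∈ M) (hshell : equation ε γ z = 0)
    (htangent : equation ε γ (0, Pi.single α v) = 0) :
    verticalDeriv α v (prolongApply V (equation ε γ)) z = 0 := by
  have hzero : (fun t : ℝ => prolongApply V (equation ε γ) (z + t • (0, Pi.single α v)))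
      =ᶠ[nhds 0] fun _ => 0 := by
    filter_upwards [eventually_proj_mem hM hz (0, Pi.single α v)] with t ht
    exact hV.invariance _ ht (by rw [equation_add_smul, hshell, htangent, mul_zero, add_zero])
  exact hzero.deriv_eq.trans (deriv_const _ _)

end OnShell

section ThirdOrderPart

variable {M : Set Total} {V : Total → Total} {ε γ : ℝ} {z : Jet} {α : Fin 2}
  {v : MultiIndex → ℝ}

theorem verticalDeriv_prolongApply_of_third_order (hM : IsOpen M) (hV : ContDiffOn ℝ ∞ V M)
    (hz : proj z ∈ M) (ε γ : ℝ) (hv : ∀ J, J 0 + J 1 + J 2 < 3 → v J = 0) {w : MultiIndex → ℝ}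
    (hw : w = (Pi.single α v : Fin 2 → MultiIndex → ℝ) 0) :
    verticalDeriv α v (prolongApply V (equation ε γ)) z
      = -ε * ((v (unitIndex 2 + unitIndex 0 + unitIndex 0)
            + v (unitIndex 2 + unitIndex 1 + unitIndex 1))
          * (fibreDeriv α (fibreCoeff V 0) (proj z)
            - ∑ i, fibreDeriv α (baseCoeff V i) (proj z) * z.2 0 (unitIndex i))
        - ∑ i, ((w (unitIndex i + unitIndex 0 + unitIndex 0)
              + w (unitIndex i + unitIndex 1 + unitIndex 1)) * 𝐃 2 (baseCoeff V i ∘ proj) z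
            + 2 * w (unitIndex i + unitIndex 2 + unitIndex 0) * 𝐃 0 (baseCoeff V i ∘ proj) z
            + 2 * w (unitIndex i + unitIndex 2 + unitIndex 1) * 𝐃 1 (baseCoeff V i ∘ proj) z)) := by
  have hv₀ : v 0 = 0 := hv _ (by decide)
  have hw₁ (i : Fin 3) : (Pi.single α v : Fin 2 → MultiIndex → ℝ) 0 (unitIndex i) = 0 := by
    have := hv (unitIndex i) (by revert i; decide)
    rcases eq_or_ne 0 α with rfl | hα <;> simp [*]
  have hξ := contDiffOn_baseCoeff hV
  have hφ := contDiffOn_fibreCoeff hV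
  have hLφ := ((IsDifferentialFunction.comp_proj (hφ 0)).totalViscoOp hM ε
    γ).hasLineDerivAt_verticalDeriv hM hz α v
  have hφ₁ := (IsDifferentialFunction.comp_proj (hφ 1)).hasLineDerivAt_verticalDeriv hM hz α v
  have hLξ (i : Fin 3) := ((IsDifferentialFunction.comp_proj (hξ i)).totalViscoOp hM ε
    γ).hasLineDerivAt_verticalDeriv hM hz α v
  have hu (i : Fin 3) := hasLineDerivAt_jetCoord (z := z) 0 (unitIndex i) (0, Pi.single α v)
  have hcross (i : Fin 3) :=
    hasLineDerivAt_viscoCross_comp_proj_of_third_order hM (hξ i) hv ε γ α 0 i hz hw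
  rw [verticalDeriv_eqOn hM (prolongApply_equation hM hV ε γ) α v hz]
  rw [Fin.sum_univ_three]
  have hterm (i : Fin 3) := HasDerivAt.add (HasDerivAt.mul (hLξ i) (hu i)) (hcross i)
  refine HasLineDerivAt.lineDeriv (HasDerivAt.congr_deriv (HasDerivAt.sub (HasDerivAt.sub hLφ hφ₁)
    (((hterm 0).add (hterm 1)).add (hterm 2))) ?_)
  simp only [verticalDeriv_totalViscoOp_comp_proj_of_third_order hM (hξ _) hv ε γ α hz,
    verticalDeriv_totalViscoOp_comp_proj_of_third_order hM (hφ _) hv ε γ α hz,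
    verticalDeriv_comp_proj hM (hφ _) α v hz, hv₀, hw₁, Fin.sum_univ_three, Pi.smul_apply,
    smul_eq_mul, Function.comp_apply, jetCoord, zero_smul, add_zero]
  ring

end ThirdOrderPart

section ThirdOrderConsequences

variable {M : Set Total} {V : Total → Total} {h : Total → ℝ} {ε γ : ℝ} {z : Jet}
  {v : MultiIndex → ℝ}

theorem fibreDeriv_comp_proj_eq_zero (hM : IsOpen M) (hh : ContDiffOn ℝ ∞ h M) {k : Fin 3} {c : ℝ}
    (hc : Set.EqOn (𝐃 k (h ∘ proj)) (fun _ => c) (proj ⁻¹' M)) (α : Fin 2) :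
    Set.EqOn (fibreDeriv α h ∘ proj) 0 (proj ⁻¹' M) := by
  intro z hz
  have hv := verticalDeriv_eqOn hM hc α (Pi.single (unitIndex k) 1) hz
  have h0 : (Pi.single (unitIndex k) 1 : MultiIndex → ℝ) 0 = 0 :=
    Pi.single_eq_of_ne (fun h => by simpa [unitIndex] using congrFun h k) _
  rw [verticalDeriv_totalDeriv_comp_proj hM hh α k _ hz, verticalDeriv_const] at hv
  simpa [h0] using hv

theorem equation_vertical_of_third_order (ε γ : ℝ) (α : Fin 2)
    (hv : ∀ J, J 0 + J 1 + J 2 < 3 → v J = 0) {w : MultiIndex → ℝ}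
    (hw : w = (Pi.single α v : Fin 2 → MultiIndex → ℝ) 0)
    (hshell : w (unitIndex 2 + unitIndex 0 + unitIndex 0)
      + w (unitIndex 2 + unitIndex 1 + unitIndex 1) = 0) :
    equation ε γ (0, Pi.single α v) = 0 := by
  have hxxt : unitIndex 2 + unitIndex 0 + unitIndex 0 = ![2, 0, 1] := by decide
  have hyyt : unitIndex 2 + unitIndex 1 + unitIndex 1 = ![0, 2, 1] := by decide
  rw [hxxt, hyyt, hw] at hshell
  fin_cases α <;> simp_all [equation]

namespace IsInfinitesimalSymmetry

theorem sum_third_order_eq_zero (hM : IsOpen M) (hε : ε ≠ 0)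
    (hV : IsInfinitesimalSymmetry ε γ M V) (hv : ∀ J, J 0 + J 1 + J 2 < 3 → v J = 0)
    (hshell : v (unitIndex 2 + unitIndex 0 + unitIndex 0)
      + v (unitIndex 2 + unitIndex 1 + unitIndex 1) = 0) (hz : proj z ∈ M) :
    ∑ i, ((v (unitIndex i + unitIndex 0 + unitIndex 0)
          + v (unitIndex i + unitIndex 1 + unitIndex 1)) * 𝐃 2 (baseCoeff V i ∘ proj) z
        + 2 * v (unitIndex i + unitIndex 2 + unitIndex 0) * 𝐃 0 (baseCoeff V i ∘ proj) z
        + 2 * v (unitIndex i + unitIndex 2 + unitIndex 1) * 𝐃 1 (baseCoeff V i ∘ proj) z) = 0 := by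
  have hz' : proj (toShell ε γ z) ∈ M := (proj_toShell ε γ z).symm ▸ hz
  have h := hV.verticalDeriv_prolongApply hM hz' (equation_toShell ε γ z)
    (equation_vertical_of_third_order ε γ 0 hv (by simp) hshell)
  rw [verticalDeriv_prolongApply_of_third_order hM hV.smooth hz' ε γ hv (w := v) (by simp),
    hshell, zero_mul, zero_sub, neg_mul_neg, mul_eq_zero_iff_left hε] at h
  simpa only [totalDeriv_comp_proj_toShell hM (contDiffOn_baseCoeff hV.smooth _) hz] using h

theorem isBaseConformal (hM : IsOpen M) (hε : ε ≠ 0) (hV : IsInfinitesimalSymmetry ε γ M V) :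
    IsBaseConformal M V := by
  have hsingle {J : MultiIndex} (hJ : J 0 + J 1 + J 2 = 3) (K : MultiIndex)
      (hK : K 0 + K 1 + K 2 < 3) : (Pi.single J 1 : MultiIndex → ℝ) K = 0 := by
    have hKJ : K ≠ J := by rintro rfl; omega
    simp [hKJ]
  have hcoeff {J : MultiIndex} (hJ : J 0 + J 1 + J 2 = 3) (hxxt : J ≠ ![2, 0, 1])
      (hyyt : J ≠ ![0, 2, 1]) {z : Jet} (hz : proj z ∈ M) :=
    hV.sum_third_order_eq_zero hM hε (hsingle hJ) (by
      have hxxt' : unitIndex 2 + unitIndex 0 + unitIndex 0 = ![2, 0, 1] := by decide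
      have hyyt' : unitIndex 2 + unitIndex 1 + unitIndex 1 = ![0, 2, 1] := by decide
      simp [hxxt', hyyt', hxxt.symm, hyyt.symm]) hz
  refine ⟨fun z hz => ?_, fun z hz => ?_, fun z hz => ?_, fun z hz => ?_, fun z hz => ?_,
    fun z hz => ?_⟩
  · simpa (decide := true) [Fin.sum_univ_three, Pi.single_apply]
      using hcoeff (J := ![3, 0, 0]) (by decide) (by decide) (by decide) hz
  · simpa (decide := true) [Fin.sum_univ_three, Pi.single_apply]
      using hcoeff (J := ![0, 3, 0]) (by decide) (by decide) (by decide) hz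
  · simpa (decide := true) [Fin.sum_univ_three, Pi.single_apply]
      using hcoeff (J := ![1, 0, 2]) (by decide) (by decide) (by decide) hz
  · simpa (decide := true) [Fin.sum_univ_three, Pi.single_apply]
      using hcoeff (J := ![0, 1, 2]) (by decide) (by decide) (by decide) hz
  · have hxyt := hcoeff (J := ![1, 1, 1]) (by decide) (by decide) (by decide) hz
    simp (decide := true) only [Fin.sum_univ_three, Pi.single_apply, if_true, if_false] at hxyt
    simp only [Pi.neg_apply]
    linarith
  · have hxxt_yyt := hV.sum_third_order_eq_zero hM hε
      (v := Pi.single ![2, 0, 1] 1 - Pi.single ![0, 2, 1] 1)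
      (fun K hK => by simp [hsingle (J := ![2, 0, 1]) (by decide) K hK,
        hsingle (J := ![0, 2, 1]) (by decide) K hK])
      (by simp (decide := true) [Pi.single_apply]) hz
    simp (decide := true) only [Fin.sum_univ_three, Pi.sub_apply, Pi.single_apply, if_true,
      if_false] at hxxt_yyt
    linarith

end IsInfinitesimalSymmetry

end ThirdOrderConsequences

section BaseConformal

variable {M : Set Total} {V : Total → Total}

theorem totalDeriv_eq_zero_of_eqOn_zero (hM : IsOpen M) {P : Jet → ℝ}
    (hP : Set.EqOn P 0 (proj ⁻¹' M)) (k : Fin 3) : Set.EqOn (𝐃 k P) 0 (proj ⁻¹' M) :=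
  (totalDeriv_eqOn hM hP k).trans fun _ _ => congrFun (totalDeriv_const k 0) _

theorem totalDeriv_neg (k : Fin 3) (P : Jet → ℝ) : 𝐃 k (-P) = -𝐃 k P :=
  funext fun _ => deriv.fun_neg

namespace IsBaseConformal

variable (hM : IsOpen M) (hV : ContDiffOn ℝ ∞ V M) (hC : IsBaseConformal M V)
include hM hV hC

theorem fibreDeriv_baseCoeff (i : Fin 3) (α : Fin 2) :
    Set.EqOn (fibreDeriv α (baseCoeff V i) ∘ proj) 0 (proj ⁻¹' M) := by
  fin_cases i
  · exact fibreDeriv_comp_proj_eq_zero hM (contDiffOn_baseCoeff hV 0) hC.totalDeriv_time_zero α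
  · exact fibreDeriv_comp_proj_eq_zero hM (contDiffOn_baseCoeff hV 1) hC.totalDeriv_time_one α
  · exact fibreDeriv_comp_proj_eq_zero hM (contDiffOn_baseCoeff hV 2) hC.totalDeriv_zero_time α

theorem totalDeriv_time_strain :
    Set.EqOn (𝐃 2 (𝐃 0 (baseCoeff V 0 ∘ proj))) 0 (proj ⁻¹' M) :=
  ((IsDifferentialFunction.comp_proj (contDiffOn_baseCoeff hV 0)).totalDeriv_comm hM 0 2).trans
    (totalDeriv_eq_zero_of_eqOn_zero hM hC.totalDeriv_time_zero 0)

theorem laplace_zero : Set.EqOn (𝐃 0 (𝐃 0 (baseCoeff V 0 ∘ proj)))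
    (-𝐃 1 (𝐃 1 (baseCoeff V 0 ∘ proj))) (proj ⁻¹' M) := by
  have hξ := IsDifferentialFunction.comp_proj (contDiffOn_baseCoeff hV 1)
  intro z hz
  rw [Pi.neg_apply, totalDeriv_eqOn hM hC.shear 1 hz, totalDeriv_neg, Pi.neg_apply, neg_neg,
    hξ.totalDeriv_comm hM 0 1 hz, totalDeriv_eqOn hM hC.strain 0 hz]

theorem laplace_one : Set.EqOn (𝐃 0 (𝐃 0 (baseCoeff V 1 ∘ proj)))
    (-𝐃 1 (𝐃 1 (baseCoeff V 1 ∘ proj))) (proj ⁻¹' M) := by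
  have hξ := IsDifferentialFunction.comp_proj (contDiffOn_baseCoeff hV 0)
  intro z hz
  rw [Pi.neg_apply, totalDeriv_eqOn hM hC.strain 1 hz, hξ.totalDeriv_comm hM 0 1 hz,
    totalDeriv_eqOn hM hC.shear 0 hz, totalDeriv_neg, Pi.neg_apply, neg_neg]

end IsBaseConformal

end BaseConformal

section ReducedSymmetryCondition

variable {M : Set Total} {V : Total → Total} {z : Jet}
variable (hM : IsOpen M) (hV : ContDiffOn ℝ ∞ V M) (hC : IsBaseConformal M V) (ε γ : ℝ)
include hM hV hC

/-- With `λ = D_x ξ^0` and `τ = D_t ξ^2`, a conformal base field contributes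
`-D_t τ u_t - 2 τ u_tt + ε (2 λ + τ) Δu_t + 2 γ λ Δu`. -/
theorem IsBaseConformal.prolongApply_equation :
    Set.EqOn (prolongApply V (equation ε γ)) (totalViscoOp ε γ (fibreCoeff V 0 ∘ proj)
      - fibreCoeff V 1 ∘ proj
      - 𝐃 2 (𝐃 2 (baseCoeff V 2 ∘ proj)) * jetCoord 0 (unitIndex 2)
      - (2 : ℝ) • (𝐃 2 (baseCoeff V 2 ∘ proj) * jetCoord 0 (unitIndex 2 + unitIndex 2))
      + ε • (((2 : ℝ) • 𝐃 0 (baseCoeff V 0 ∘ proj) + 𝐃 2 (baseCoeff V 2 ∘ proj))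
        * (jetCoord 0 (unitIndex 2 + unitIndex 0 + unitIndex 0)
          + jetCoord 0 (unitIndex 2 + unitIndex 1 + unitIndex 1)))
      + (2 * γ) • (𝐃 0 (baseCoeff V 0 ∘ proj)
        * (jetCoord 0 (unitIndex 0 + unitIndex 0) + jetCoord 0 (unitIndex 1 + unitIndex 1))))
      (proj ⁻¹' M) := by
  have hT := IsDifferentialFunction.comp_proj (contDiffOn_baseCoeff hV 2)
  have hDzero {P : Jet → ℝ} (hP : Set.EqOn P 0 (proj ⁻¹' M)) (k : Fin 3) :=
    totalDeriv_eq_zero_of_eqOn_zero hM hP k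
  have hXt := hC.totalDeriv_time_zero
  have hYt := hC.totalDeriv_time_one
  have hTx := hC.totalDeriv_zero_time
  have hTy := hC.totalDeriv_one_time
  have hTtx := (hT.totalDeriv_comm hM 2 0).trans (hDzero hTx 2)
  have hTty := (hT.totalDeriv_comm hM 2 1).trans (hDzero hTy 2)
  intro z hz
  rw [Viscoelastic.prolongApply_equation hM hV ε γ hz]
  simp only [totalViscoOp, viscoCross, totalDeriv_jetCoord, Fin.sum_univ_three, Pi.sub_apply,
    Pi.add_apply, Pi.smul_apply, Pi.mul_apply, Pi.neg_apply, Pi.ofNat_apply,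
    smul_eq_mul, hXt hz, hYt hz, hTx hz, hTy hz, hTtx hz, hTty hz, hDzero hXt _ hz,
    hDzero hYt _ hz, hDzero hTx _ hz, hDzero hTy _ hz, hDzero (hDzero hXt _) _ hz,
    hDzero (hDzero hYt _) _ hz, hDzero hTtx _ hz, hDzero hTty _ hz, hC.laplace_zero hM hV hz,
    hC.laplace_one hM hV hz, hC.shear hz, hC.strain hz]
  simp only [jetCoord, add_comm (unitIndex 0) (unitIndex 1), add_comm (unitIndex 2), ← add_assoc,
    add_right_comm _ (unitIndex 2)]
  ring

end ReducedSymmetryCondition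

section LowerOrder

variable {M : Set Total} {V : Total → Total} {ε γ : ℝ} {z : Jet} {v : MultiIndex → ℝ}

/-- The derivative of `viscoCross ε γ g u` in the vertical direction `v` of the `u`-coordinates, if
`g` and its total derivatives are constant in that direction. -/
def verticalViscoCross (ε γ : ℝ) (v : MultiIndex → ℝ) (g : Jet → ℝ) : Jet → ℝ := fun z =>
  2 * v (unitIndex 2) * 𝐃 2 g z
    - ε * ((v (unitIndex 0 + unitIndex 0) + v (unitIndex 1 + unitIndex 1)) * 𝐃 2 g z
      + v (unitIndex 2) * (𝐃 0 (𝐃 0 g) z + 𝐃 1 (𝐃 1 g) z)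
      + 2 * (v (unitIndex 2 + unitIndex 0) * 𝐃 0 g z + v (unitIndex 0) * 𝐃 0 (𝐃 2 g) z
        + v (unitIndex 2 + unitIndex 1) * 𝐃 1 g z + v (unitIndex 1) * 𝐃 1 (𝐃 2 g) z))
    - 2 * γ * (v (unitIndex 0) * 𝐃 0 g z + v (unitIndex 1) * 𝐃 1 g z)

theorem equation_vertical (ε γ : ℝ) (v : MultiIndex → ℝ) :
    equation ε γ (0, Pi.single 0 v) = v (unitIndex 2 + unitIndex 2)
      - ε * (v (unitIndex 2 + unitIndex 0 + unitIndex 0)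
        + v (unitIndex 2 + unitIndex 1 + unitIndex 1))
      - γ * (v (unitIndex 0 + unitIndex 0) + v (unitIndex 1 + unitIndex 1)) := by
  have htt : unitIndex 2 + unitIndex 2 = ![0, 0, 2] := by decide
  have hxxt : unitIndex 2 + unitIndex 0 + unitIndex 0 = ![2, 0, 1] := by decide
  have hyyt : unitIndex 2 + unitIndex 1 + unitIndex 1 = ![0, 2, 1] := by decide
  have hxx : unitIndex 0 + unitIndex 0 = ![2, 0, 0] := by decide
  have hyy : unitIndex 1 + unitIndex 1 = ![0, 2, 0] := by decide
  simp [equation, htt, hxxt, hyyt, hxx, hyy]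

variable (hM : IsOpen M)
include hM

theorem verticalDeriv_totalViscoOp_comp_proj {h : Total → ℝ} (hh : ContDiffOn ℝ ∞ h M)
    (ε γ : ℝ) (hv : v 0 = 0) :
    Set.EqOn (verticalDeriv 0 v (totalViscoOp ε γ (h ∘ proj)))
      (equation ε γ (0, Pi.single 0 v) • (fibreDeriv 0 h ∘ proj)
        + verticalViscoCross ε γ v (fibreDeriv 0 h ∘ proj)) (proj ⁻¹' M) := by
  intro z hz
  simp only [(IsDifferentialFunction.comp_proj hh).verticalDeriv_totalViscoOp hM ε γ 0 v hz,
    Pi.sub_apply, Pi.add_apply, Pi.smul_apply, smul_eq_mul, hv, equation_vertical,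
    verticalViscoCross, verticalDeriv_totalDeriv_totalDeriv_comp_proj hM hh 0 v _ _ hz,
    verticalDeriv_totalDeriv_totalDeriv_totalDeriv_comp_proj hM hh 0 v _ _ _ hz]
  ring

theorem verticalDeriv_totalDeriv_eq_zero {P : Jet → ℝ} (hP : IsDifferentialFunction M P)
    {α : Fin 2} (hPv : ∀ v, Set.EqOn (verticalDeriv α v P) 0 (proj ⁻¹' M)) (k : Fin 3)
    (v : MultiIndex → ℝ) : Set.EqOn (verticalDeriv α v (𝐃 k P)) 0 (proj ⁻¹' M) := by
  intro z hz
  rw [hP.verticalDeriv_totalDeriv hM α k v hz, Pi.add_apply,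
    totalDeriv_eq_zero_of_eqOn_zero hM (hPv v) k hz, hPv _ hz, Pi.zero_apply, add_zero]

theorem IsBaseConformal.verticalDeriv_prolongApply (hV : ContDiffOn ℝ ∞ V M)
    (hC : IsBaseConformal M V) (ε γ : ℝ) (hv : v 0 = 0) (hz : proj z ∈ M) :
    verticalDeriv 0 v (prolongApply V (equation ε γ)) z
      = verticalDeriv 0 v (totalViscoOp ε γ (fibreCoeff V 0 ∘ proj)) z
        - 𝐃 2 (𝐃 2 (baseCoeff V 2 ∘ proj)) z * v (unitIndex 2)
        - 2 * (𝐃 2 (baseCoeff V 2 ∘ proj) z * v (unitIndex 2 + unitIndex 2))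
        + ε * ((2 * 𝐃 0 (baseCoeff V 0 ∘ proj) z + 𝐃 2 (baseCoeff V 2 ∘ proj) z)
          * (v (unitIndex 2 + unitIndex 0 + unitIndex 0)
            + v (unitIndex 2 + unitIndex 1 + unitIndex 1)))
        + 2 * γ * (𝐃 0 (baseCoeff V 0 ∘ proj) z
          * (v (unitIndex 0 + unitIndex 0) + v (unitIndex 1 + unitIndex 1))) := by
  have hξ (i : Fin 3) := IsDifferentialFunction.comp_proj (contDiffOn_baseCoeff hV i)
  have hφ (α : Fin 2) := IsDifferentialFunction.comp_proj (contDiffOn_fibreCoeff hV α)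
  have hξv (i : Fin 3) (v : MultiIndex → ℝ) :
      Set.EqOn (verticalDeriv 0 v (baseCoeff V i ∘ proj)) 0 (proj ⁻¹' M) := fun z hz => by
    rw [verticalDeriv_comp_proj hM (contDiffOn_baseCoeff hV i) 0 v hz, Pi.smul_apply,
      hC.fibreDeriv_baseCoeff hM hV i 0 hz, Pi.zero_apply, smul_zero]
  have hDξv (i k : Fin 3) := verticalDeriv_totalDeriv_eq_zero hM (hξ i) (hξv i) k
  have hDDξv (i k l : Fin 3) :=
    verticalDeriv_totalDeriv_eq_zero hM ((hξ i).totalDeriv hM k) (hDξv i k) l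
  have hDξ (i k : Fin 3) (J : MultiIndex) :=
    ((hξ i).totalDeriv hM k).hasLineDerivAt_mul_jetCoord hM hz (hDξv i k v hz) 0 J
  have hDDξ (i k l : Fin 3) (J : MultiIndex) :=
    (((hξ i).totalDeriv hM k).totalDeriv hM l).hasLineDerivAt_mul_jetCoord hM hz
      (hDDξv i k l v hz) 0 J
  have hLφ := ((hφ 0).totalViscoOp hM ε γ).hasLineDerivAt_verticalDeriv hM hz 0 v
  have hφ₁ := (hφ 1).hasLineDerivAt_verticalDeriv hM hz 0 v
  rw [verticalDeriv_eqOn hM (hC.prolongApply_equation hM hV ε γ) 0 v hz]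
  simp only [mul_add, add_mul, smul_mul_assoc]
  refine HasLineDerivAt.lineDeriv (HasDerivAt.congr_deriv (((((hLφ.sub hφ₁).sub
    (hDDξ 2 2 2 _)).sub ((hDξ 2 2 _).const_smul 2)).add
      (((((hDξ 0 0 _).const_smul 2).add (hDξ 2 2 _)).add
        (((hDξ 0 0 _).const_smul 2).add (hDξ 2 2 _))).const_smul ε)).add
    (((hDξ 0 0 _).add (hDξ 0 0 _)).const_smul (2 * γ))) ?_)
  rw [verticalDeriv_comp_proj hM (contDiffOn_fibreCoeff hV 1) 0 v hz]
  simp only [Pi.smul_apply, hv, smul_eq_mul, Pi.single_eq_same]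
  ring

namespace IsInfinitesimalSymmetry

theorem verticalViscoCross_add_eq_zero (hV : IsInfinitesimalSymmetry ε γ M V)
    (hC : IsBaseConformal M V) (hv : v 0 = 0) (htangent : equation ε γ (0, Pi.single 0 v) = 0)
    (hz : proj z ∈ M) (hshell : equation ε γ z = 0) :
    verticalViscoCross ε γ v (fibreDeriv 0 (fibreCoeff V 0) ∘ proj) z
      - 𝐃 2 (𝐃 2 (baseCoeff V 2 ∘ proj)) z * v (unitIndex 2)
      + ε * (2 * 𝐃 0 (baseCoeff V 0 ∘ proj) z - 𝐃 2 (baseCoeff V 2 ∘ proj) z)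
        * (v (unitIndex 2 + unitIndex 0 + unitIndex 0)
          + v (unitIndex 2 + unitIndex 1 + unitIndex 1))
      + 2 * γ * (𝐃 0 (baseCoeff V 0 ∘ proj) z - 𝐃 2 (baseCoeff V 2 ∘ proj) z)
        * (v (unitIndex 0 + unitIndex 0) + v (unitIndex 1 + unitIndex 1)) = 0 := by
  have h := hV.verticalDeriv_prolongApply hM hz hshell htangent
  rw [hC.verticalDeriv_prolongApply hM hV.smooth ε γ hv hz,
    verticalDeriv_totalViscoOp_comp_proj hM (contDiffOn_fibreCoeff hV.smooth 0) ε γ hv hz,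
    htangent, zero_smul, zero_add] at h
  rw [equation_vertical] at htangent
  linear_combination h + 2 * 𝐃 2 (baseCoeff V 2 ∘ proj) z * htangent

variable (hV : IsInfinitesimalSymmetry ε γ M V) (hC : IsBaseConformal M V)
include hV hC

theorem totalDeriv_time_two (hε : ε ≠ 0) : Set.EqOn (𝐃 2 (baseCoeff V 2 ∘ proj))
    ((2 : ℝ) • 𝐃 0 (baseCoeff V 0 ∘ proj)) (proj ⁻¹' M) := by
  intro z hz
  have hξ := contDiffOn_baseCoeff hV.smooth
  have h := hV.verticalViscoCross_add_eq_zero hM hC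
    (v := Pi.single ![2, 0, 1] 1 + Pi.single ![0, 0, 2] ε)
    (by simp (decide := true)) (by simp (decide := true) [equation_vertical, Pi.single_apply])
    ((proj_toShell ε γ z).symm ▸ hz) (equation_toShell ε γ z)
  simp (decide := true) only [verticalViscoCross, Pi.add_apply, Pi.single_apply, if_true, if_false,
    totalDeriv_comp_proj_toShell hM (hξ _) hz] at h
  have h' : ε * (2 * 𝐃 0 (baseCoeff V 0 ∘ proj) z - 𝐃 2 (baseCoeff V 2 ∘ proj) z) = 0 := by
    linear_combination h
  rw [Pi.smul_apply, smul_eq_mul]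
  linear_combination -(mul_eq_zero.1 h').resolve_left hε

theorem totalDeriv_space_fibreDeriv (hε : ε ≠ 0) {k : Fin 3} (hk : k ≠ 2) :
    Set.EqOn (𝐃 k (fibreDeriv 0 (fibreCoeff V 0) ∘ proj)) 0 (proj ⁻¹' M) := by
  intro z hz
  have hψ := contDiffOn_fibreDeriv hM (contDiffOn_fibreCoeff hV.smooth 0) 0
  have hcoeff (J : MultiIndex) (hJ : (Pi.single J 1 : MultiIndex → ℝ) 0 = 0)
      (htangent : equation ε γ (0, Pi.single 0 (Pi.single J 1)) = 0) :=
    hV.verticalViscoCross_add_eq_zero hM hC hJ htangent ((proj_toShell ε γ z).symm ▸ hz)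
      (equation_toShell ε γ z)
  obtain rfl | rfl : k = 0 ∨ k = 1 := by omega
  · have hxt := hcoeff ![1, 0, 1] (by simp (decide := true))
      (by simp (decide := true) [equation_vertical])
    simp (decide := true) only [verticalViscoCross, Pi.single_apply, if_true, if_false] at hxt
    simpa [totalDeriv_comp_proj_toShell hM hψ hz, hε] using hxt
  · have hyt := hcoeff ![0, 1, 1] (by simp (decide := true))
      (by simp (decide := true) [equation_vertical])
    simp (decide := true) only [verticalViscoCross, Pi.single_apply, if_true, if_false] at hyt
    simpa [totalDeriv_comp_proj_toShell hM hψ hz, hε] using hyt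

theorem totalDeriv_time_time_two (hε : ε ≠ 0) :
    Set.EqOn (𝐃 2 (𝐃 2 (baseCoeff V 2 ∘ proj))) 0 (proj ⁻¹' M) := by
  have hξ := IsDifferentialFunction.comp_proj (contDiffOn_baseCoeff hV.smooth 0)
  intro z hz
  rw [totalDeriv_eqOn hM (hV.totalDeriv_time_two hM hC hε) 2 hz,
    (hξ.totalDeriv hM 0).totalDeriv_const_smul hM 2 2 hz, Pi.smul_apply,
    hC.totalDeriv_time_strain hM hV.smooth hz, Pi.zero_apply, smul_zero]

theorem totalDeriv_fibreDeriv (hε : ε ≠ 0) (k : Fin 3) :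
    Set.EqOn (𝐃 k (fibreDeriv 0 (fibreCoeff V 0) ∘ proj)) 0 (proj ⁻¹' M) := by
  rcases ne_or_eq k 2 with hk | rfl
  · exact hV.totalDeriv_space_fibreDeriv hM hC hε hk
  intro z hz
  have hz' : proj (toShell ε γ z) ∈ M := (proj_toShell ε γ z).symm ▸ hz
  have hψ := contDiffOn_fibreDeriv hM (contDiffOn_fibreCoeff hV.smooth 0) 0
  have hDDψ {k : Fin 3} (hk : k ≠ 2) := totalDeriv_eq_zero_of_eqOn_zero hM
    (hV.totalDeriv_space_fibreDeriv hM hC hε hk) k hz'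
  have ht := hV.verticalViscoCross_add_eq_zero hM hC (v := Pi.single ![0, 0, 1] 1)
    (by simp (decide := true)) (by simp (decide := true) [equation_vertical]) hz'
    (equation_toShell ε γ z)
  simp (decide := true) only [verticalViscoCross, Pi.single_apply, if_true, if_false] at ht
  simpa [totalDeriv_comp_proj_toShell hM hψ hz, hV.totalDeriv_time_time_two hM hC hε hz',
    hDDψ (k := 0) (by decide), hDDψ (k := 1) (by decide)] using ht

theorem strain_eq_zero (hε : ε ≠ 0) (hγ : γ ≠ 0) :
    Set.EqOn (𝐃 0 (baseCoeff V 0 ∘ proj)) 0 (proj ⁻¹' M) := by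
  intro z hz
  have hz' : proj (toShell ε γ z) ∈ M := (proj_toShell ε γ z).symm ▸ hz
  have hξ := contDiffOn_baseCoeff hV.smooth
  have hxx := hV.verticalViscoCross_add_eq_zero hM hC
    (v := Pi.single ![2, 0, 0] 1 + Pi.single ![0, 0, 2] γ) (by simp (decide := true))
    (by simp (decide := true) [equation_vertical, Pi.single_apply]) hz' (equation_toShell ε γ z)
  have hτ := hV.totalDeriv_time_two hM hC hε hz
  simp (decide := true) only [verticalViscoCross, Pi.add_apply, Pi.single_apply, if_true, if_false,
    hV.totalDeriv_fibreDeriv hM hC hε 2 hz', totalDeriv_comp_proj_toShell hM (hξ _) hz, hτ,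
    Pi.smul_apply, smul_eq_mul, Pi.zero_apply] at hxx
  have hγstrain : γ * 𝐃 0 (baseCoeff V 0 ∘ proj) z = 0 := by linear_combination -(1 / 2 : ℝ) * hxx
  exact (mul_eq_zero.1 hγstrain).resolve_left hγ

end IsInfinitesimalSymmetry

end LowerOrder

section BaseOperators

variable {s : Set Base} {F G : Base → ℝ}

theorem contDiffOn_pderiv (hs : IsOpen s) (hF : ContDiffOn ℝ ∞ F s) (k : Fin 3) :
    ContDiffOn ℝ ∞ (pderiv k F) s := contDiffOn_lieDeriv hs contDiffOn_const hF

theorem contDiffOn_laplacian (hs : IsOpen s) (hF : ContDiffOn ℝ ∞ F s) :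
    ContDiffOn ℝ ∞ (laplacian F) s :=
  (contDiffOn_pderiv hs (contDiffOn_pderiv hs hF 0) 0).add
    (contDiffOn_pderiv hs (contDiffOn_pderiv hs hF 1) 1)

theorem contDiffOn_viscoOp (hs : IsOpen s) (hF : ContDiffOn ℝ ∞ F s) (ε γ : ℝ) :
    ContDiffOn ℝ ∞ (viscoOp ε γ F) s :=
  ((contDiffOn_pderiv hs (contDiffOn_pderiv hs hF 2) 2).sub (contDiffOn_const.mul
    (contDiffOn_pderiv hs (contDiffOn_laplacian hs hF) 2))).sub
      (contDiffOn_const.mul (contDiffOn_laplacian hs hF))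

theorem pderiv_eqOn (hs : IsOpen s) (hFG : Set.EqOn F G s) (k : Fin 3) :
    Set.EqOn (pderiv k F) (pderiv k G) s := lieDeriv_eqOn hs hFG

theorem pderiv_linearComb (hs : IsOpen s) (hF : ContDiffOn ℝ ∞ F s) (hG : ContDiffOn ℝ ∞ G s)
    (a b : ℝ) (k : Fin 3) :
    Set.EqOn (pderiv k (a • F + b • G)) (a • pderiv k F + b • pderiv k G) s :=
  lieDeriv_linearComb hs hF hG a b

theorem laplacian_linearComb (hs : IsOpen s) (hF : ContDiffOn ℝ ∞ F s)
    (hG : ContDiffOn ℝ ∞ G s) (a b : ℝ) :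
    Set.EqOn (laplacian (a • F + b • G)) (a • laplacian F + b • laplacian G) s := by
  have hpp (k : Fin 3) := (pderiv_eqOn hs (pderiv_linearComb hs hF hG a b k) k).trans
    (pderiv_linearComb hs (contDiffOn_pderiv hs hF k) (contDiffOn_pderiv hs hG k) a b k)
  intro q hq
  simp only [laplacian, hpp _ hq, Pi.add_apply, Pi.smul_apply, smul_eq_mul]
  ring

theorem viscoOp_linearComb (hs : IsOpen s) (hF : ContDiffOn ℝ ∞ F s)
    (hG : ContDiffOn ℝ ∞ G s) (ε γ a b : ℝ) :
    Set.EqOn (viscoOp ε γ (a • F + b • G)) (a • viscoOp ε γ F + b • viscoOp ε γ G) s := by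
  have htt := (pderiv_eqOn hs (pderiv_linearComb hs hF hG a b 2) 2).trans
    (pderiv_linearComb hs (contDiffOn_pderiv hs hF 2) (contDiffOn_pderiv hs hG 2) a b 2)
  have hΔ := laplacian_linearComb hs hF hG a b
  have htΔ := (pderiv_eqOn hs hΔ 2).trans
    (pderiv_linearComb hs (contDiffOn_laplacian hs hF) (contDiffOn_laplacian hs hG) a b 2)
  intro q hq
  simp only [viscoOp, htt hq, hΔ hq, htΔ hq, Pi.add_apply, Pi.smul_apply, smul_eq_mul]
  ring

end BaseOperators

section KillingField

/-- The sum of an infinitesimal rotation of `(x, y)` and an infinitesimal translation of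
`(x, y, t)`. -/
def killingField (c₁ c₂ c₃ c₄ : ℝ) : Base → Base :=
  fun q => ![c₁ * q 1 + c₂, -c₁ * q 0 + c₃, c₄]

variable {s : Set Base} {F : Base → ℝ} (c₁ c₂ c₃ c₄ : ℝ)

theorem fderiv_killingField (q v : Base) :
    fderiv ℝ (killingField c₁ c₂ c₃ c₄) q v = ![c₁ * v 1, -c₁ * v 0, 0] := by
  have hd : HasFDerivAt (killingField c₁ c₂ c₃ c₄) (ContinuousLinearMap.pi
      ![c₁ • (.proj 1 : Base →L[ℝ] ℝ), -c₁ • (.proj 0 : Base →L[ℝ] ℝ), 0]) q := by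
    refine hasFDerivAt_pi.2 fun i => ?_
    fin_cases i
    · exact ((hasFDerivAt_apply 1 q).const_mul c₁).add_const c₂
    · exact ((hasFDerivAt_apply 0 q).const_mul (-c₁)).add_const c₃
    · exact hasFDerivAt_const c₄ q
  rw [hd.fderiv]
  ext i
  fin_cases i <;> simp

theorem contDiff_killingField : ContDiff ℝ ∞ (killingField c₁ c₂ c₃ c₄) := by
  refine contDiff_pi.2 fun i => ?_
  fin_cases i
  · exact (contDiff_const.mul (contDiff_apply ℝ ℝ 1)).add contDiff_const
  · exact (contDiff_const.mul (contDiff_apply ℝ ℝ 0)).add contDiff_const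
  · exact contDiff_const

theorem lieDeriv_killingField_pderiv (hs : IsOpen s) (hF : ContDiffOn ℝ ∞ F s) (k : Fin 3) :
    Set.EqOn (lieDeriv (killingField c₁ c₂ c₃ c₄) (pderiv k F))
      (pderiv k (lieDeriv (killingField c₁ c₂ c₃ c₄) F)
        + ![c₁ • pderiv 1 F, -c₁ • pderiv 0 F, 0] k) s := by
  intro q hq
  have h := lieDeriv_lieDeriv (Y := fun _ => Pi.single k 1) hs
    (contDiff_killingField c₁ c₂ c₃ c₄).contDiffOn contDiffOn_const hF hq
  have hbracket : VectorField.lieBracket ℝ (killingField c₁ c₂ c₃ c₄) (fun _ => Pi.single k 1) q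
      = ![c₁ • Pi.single 1 1, -c₁ • Pi.single 0 1, (0 : Base)] k := by
    simp only [VectorField.lieBracket, fderiv_fun_const, fderiv_killingField]
    ext i
    fin_cases k <;> fin_cases i <;> simp
  refine h.trans (congrArg (pderiv k (lieDeriv (killingField c₁ c₂ c₃ c₄) F) q + ·) ?_)
  rw [lieDeriv, hbracket]
  fin_cases k <;> simp [pderiv]

theorem lieDeriv_killingField_laplacian (hs : IsOpen s) (hF : ContDiffOn ℝ ∞ F s) :
    Set.EqOn (lieDeriv (killingField c₁ c₂ c₃ c₄) (laplacian F))
      (laplacian (lieDeriv (killingField c₁ c₂ c₃ c₄) F)) s := by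
  have hp := contDiffOn_pderiv hs hF
  have hXF := contDiffOn_lieDeriv hs (contDiff_killingField c₁ c₂ c₃ c₄).contDiffOn hF
  have hcomm : Set.EqOn (pderiv 0 (pderiv 1 F)) (pderiv 1 (pderiv 0 F)) s :=
    lieDeriv_const_comm hs hF _ _
  have h0 : Set.EqOn (lieDeriv (killingField c₁ c₂ c₃ c₄) (pderiv 0 F))
      ((1 : ℝ) • pderiv 0 (lieDeriv (killingField c₁ c₂ c₃ c₄) F) + c₁ • pderiv 1 F) s := by
    simpa using lieDeriv_killingField_pderiv c₁ c₂ c₃ c₄ hs hF 0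
  have h1 : Set.EqOn (lieDeriv (killingField c₁ c₂ c₃ c₄) (pderiv 1 F))
      ((1 : ℝ) • pderiv 1 (lieDeriv (killingField c₁ c₂ c₃ c₄) F) + -c₁ • pderiv 0 F) s := by
    simpa using lieDeriv_killingField_pderiv c₁ c₂ c₃ c₄ hs hF 1
  have hΔ : laplacian F = (1 : ℝ) • pderiv 0 (pderiv 0 F) + (1 : ℝ) • pderiv 1 (pderiv 1 F) := by
    ext q; simp [laplacian]
  intro q hq
  rw [hΔ, lieDeriv_linearComb hs (contDiffOn_pderiv hs (hp 0) 0) (contDiffOn_pderiv hs (hp 1) 1)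
    1 1 hq]
  simp only [Pi.add_apply, Pi.smul_apply,
    lieDeriv_killingField_pderiv c₁ c₂ c₃ c₄ hs (hp _) _ hq, pderiv_eqOn hs h0 0 hq,
    pderiv_eqOn hs h1 1 hq, pderiv_linearComb hs (contDiffOn_pderiv hs hXF 0) (hp 1) _ _ _ hq,
    pderiv_linearComb hs (contDiffOn_pderiv hs hXF 1) (hp 0) _ _ _ hq, hcomm hq, laplacian]
  simp only [hcomm hq, Matrix.cons_val_zero, Matrix.cons_val_one, Pi.smul_apply, smul_eq_mul]
  ring

theorem lieDeriv_killingField_viscoOp (hs : IsOpen s) (hF : ContDiffOn ℝ ∞ F s) (ε γ : ℝ) :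
    Set.EqOn (lieDeriv (killingField c₁ c₂ c₃ c₄) (viscoOp ε γ F))
      (viscoOp ε γ (lieDeriv (killingField c₁ c₂ c₃ c₄) F)) s := by
  have hΔF := contDiffOn_laplacian hs hF
  have htt := contDiffOn_pderiv hs (contDiffOn_pderiv hs hF 2) 2
  have htΔ := contDiffOn_pderiv hs hΔF 2
  have hX {G : Base → ℝ} (hG : ContDiffOn ℝ ∞ G s) :
      Set.EqOn (lieDeriv (killingField c₁ c₂ c₃ c₄) (pderiv 2 G))
        (pderiv 2 (lieDeriv (killingField c₁ c₂ c₃ c₄) G)) s := by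
    simpa using lieDeriv_killingField_pderiv c₁ c₂ c₃ c₄ hs hG 2
  have hΔ := lieDeriv_killingField_laplacian c₁ c₂ c₃ c₄ hs hF
  have hL : viscoOp ε γ F = (1 : ℝ) • ((1 : ℝ) • pderiv 2 (pderiv 2 F)
      + -ε • pderiv 2 (laplacian F)) + -γ • laplacian F := by
    ext q
    simp [viscoOp, sub_eq_add_neg]
  intro q hq
  rw [hL, lieDeriv_linearComb hs (contDiffOn_linearComb htt htΔ 1 (-ε)) hΔF 1 _ hq]
  simp only [Pi.add_apply, Pi.smul_apply, lieDeriv_linearComb hs htt htΔ 1 _ hq,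
    hX (contDiffOn_pderiv hs hF 2) hq, pderiv_eqOn hs (hX hF) 2 hq, hX hΔF hq,
    pderiv_eqOn hs hΔ 2 hq, hΔ hq, viscoOp, smul_eq_mul]
  ring

end KillingField

section FunctionsOfTheBase

variable {s : Set Base} {F : Base → ℝ}

theorem totalDeriv_comp_fst (hs : IsOpen s) (hF : ContDiffOn ℝ ∞ F s) (k : Fin 3) :
    Set.EqOn (𝐃 k (F ∘ Prod.fst)) (pderiv k F ∘ Prod.fst) (Prod.fst ⁻¹' s) := fun _ hz =>
  (differentiableAt_of_contDiffOn hs hF hz).lineDeriv_eq_fderiv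

theorem totalDeriv_totalDeriv_comp_fst (hs : IsOpen s) (hF : ContDiffOn ℝ ∞ F s) (k l : Fin 3) :
    Set.EqOn (𝐃 l (𝐃 k (F ∘ Prod.fst))) (pderiv l (pderiv k F) ∘ Prod.fst) (Prod.fst ⁻¹' s) :=
  (totalDeriv_eqOn (M := Prod.fst ⁻¹' s) (hs.preimage continuous_fst)
    (totalDeriv_comp_fst hs hF k) l).trans
      (totalDeriv_comp_fst hs (contDiffOn_pderiv hs hF k) l)

/-- The operators `viscoOp` and `totalViscoOp` differ by the order in which `∂_t` and `Δ` are
applied; they agree as `∂_t` is a Killing field. -/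
theorem totalViscoOp_comp_fst (hs : IsOpen s) (hF : ContDiffOn ℝ ∞ F s) (ε γ : ℝ) :
    Set.EqOn (totalViscoOp ε γ (F ∘ Prod.fst)) (viscoOp ε γ F ∘ Prod.fst) (Prod.fst ⁻¹' s) := by
  have ht : killingField 0 0 0 1 = fun _ => Pi.single 2 1 := by
    ext q i
    fin_cases i <;> simp [killingField]
  have htΔ : Set.EqOn (pderiv 2 (laplacian F)) (laplacian (pderiv 2 F)) s := by
    have h := lieDeriv_killingField_laplacian 0 0 0 1 hs hF
    rwa [ht] at h
  have hDDD (k : Fin 3) := (totalDeriv_eqOn (M := Prod.fst ⁻¹' s) (hs.preimage continuous_fst)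
    (totalDeriv_totalDeriv_comp_fst hs hF 2 k) k).trans (totalDeriv_comp_fst hs
      (contDiffOn_pderiv hs (contDiffOn_pderiv hs hF 2) k) k)
  intro z hz
  simp only [totalViscoOp, viscoOp, Pi.sub_apply, Pi.add_apply, Pi.smul_apply, smul_eq_mul,
    Function.comp_apply, totalDeriv_totalDeriv_comp_fst hs hF _ _ hz, hDDD _ hz, htΔ hz]
  rfl

end FunctionsOfTheBase

section Integration

variable {E F G : Type*} [NormedAddCommGroup E] [NormedSpace ℝ E] [NormedAddCommGroup F]
  [NormedSpace ℝ F] [NormedAddCommGroup G] [NormedSpace ℝ G]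

theorem exists_eq_clm_add_comp_fst {M : Set (E × F)} (hM : IsOpen M)
    (hfib : ∀ q : E, IsPreconnected {w : F | (q, w) ∈ M}) {h : E × F → G}
    (hh : ContDiffOn ℝ ∞ h M) {L : F →L[ℝ] G}
    (hL : ∀ p ∈ M, (fderiv ℝ h p).comp (.inr ℝ E F) = L) :
    ∃ g : E → G, ContDiffOn ℝ ∞ g (Prod.fst '' M) ∧ ∀ p ∈ M, h p = L p.2 + g p.1 := by
  have hfibre (q : E) : ∃ c : G, ∀ w, (q, w) ∈ M → h (q, w) = L w + c := by
    have hd (w : F) (hw : (q, w) ∈ M) : HasFDerivAt (fun w => h (q, w)) L w :=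
      hL _ hw ▸ (differentiableAt_of_contDiffOn hM hh hw).hasFDerivAt.comp w
        (hasFDerivAt_prodMk_right q w)
    obtain ⟨c, hc⟩ := (hM.preimage (Continuous.prodMk_right q)).exists_eq_add_of_fderiv_eq
      (hfib q) (fun w hw => (hd w hw).differentiableAt.differentiableWithinAt)
      L.differentiable.differentiableOn fun w hw => by rw [(hd w hw).fderiv, L.fderiv]
    exact ⟨c, fun w hw => hc hw⟩
  choose g hg using hfibre
  refine ⟨g, ?_, fun p hp => hg p.1 p.2 hp⟩
  rintro _ ⟨⟨q, w⟩, hp, rfl⟩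
  have hslice : ContDiff ℝ ∞ fun q' : E => (q', w) := contDiff_prodMk_left w
  have hsmooth : ContDiffAt ℝ ∞ (fun q' => h (q', w) - L w) q :=
    ((hh.contDiffAt (hM.mem_nhds hp)).comp q hslice.contDiffAt).sub contDiffAt_const
  refine (hsmooth.congr_of_eventuallyEq ?_).contDiffWithinAt
  filter_upwards [hslice.continuous.continuousAt.eventually_mem (hM.mem_nhds hp)] with q' hq'
  rw [hg q' w hq', add_sub_cancel_left]

end Integration

theorem proj_surjective : Function.Surjective proj := fun p =>
  ⟨(p.1, fun α _ => p.2 α), rfl⟩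

theorem eqOn_of_comp_proj {M : Set Total} {g h : Total → ℝ}
    (hgh : Set.EqOn (g ∘ proj) (h ∘ proj) (proj ⁻¹' M)) : Set.EqOn g h M := fun p hp => by
  obtain ⟨z, rfl⟩ := proj_surjective p
  exact hgh hp

section IntegrationOfTotalDerivatives

variable {M : Set Total} {h : Total → ℝ}

theorem totalDeriv_comp_proj_of_fibreDeriv (hM : IsOpen M) (hh : ContDiffOn ℝ ∞ h M)
    (hfibre : ∀ α, Set.EqOn (fibreDeriv α h ∘ proj) 0 (proj ⁻¹' M)) (k : Fin 3) :
    Set.EqOn (𝐃 k (h ∘ proj)) (baseDeriv k h ∘ proj) (proj ⁻¹' M) := by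
  intro z hz
  have hα (α : Fin 2) : fibreDeriv α h (proj z) = 0 := hfibre α hz
  rw [totalDeriv_comp_proj hM hh k hz]
  simp [hα]

theorem exists_eq_sum_add (hM : IsOpen M) (hconn : IsPreconnected M) (hh : ContDiffOn ℝ ∞ h M)
    {c : Fin 3 → ℝ} (hc : ∀ k, Set.EqOn (𝐃 k (h ∘ proj)) (fun _ => c k) (proj ⁻¹' M)) :
    ∃ d : ℝ, ∀ p ∈ M, h p = ∑ k, c k * p.1 k + d := by
  have hfibre := fibreDeriv_comp_proj_eq_zero hM hh (hc 0)
  let L : Total →L[ℝ] ℝ := ∑ k, c k • (.proj k ∘L .fst ℝ Base Fibre)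
  have hL (p : Total) : L p = ∑ k, c k * p.1 k := by simp [L]
  have hfderiv : Set.EqOn (fderiv ℝ h) (fderiv ℝ L) M := fun p hp => by
    have hα (α : Fin 2) : fibreDeriv α h p = 0 := eqOn_of_comp_proj (h := 0) (hfibre α) hp
    have hk (k : Fin 3) : baseDeriv k h p = c k := eqOn_of_comp_proj (h := fun _ => c k)
      ((totalDeriv_comp_proj_of_fibreDeriv hM hh hfibre k).symm.trans (hc k)) hp
    refine ContinuousLinearMap.ext fun v => ?_
    simp only [fderiv_total_apply p v, hα, hk, L.fderiv, hL]
    simp [mul_comm]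
  obtain ⟨d, hd⟩ := hM.exists_eq_add_of_fderiv_eq hconn
    (fun p hp => (differentiableAt_of_contDiffOn hM hh hp).differentiableWithinAt)
    L.differentiable.differentiableOn hfderiv
  exact ⟨d, fun p hp => (hd hp).trans (congrArg (· + d) (hL p))⟩

end IntegrationOfTotalDerivatives

section BaseKilling

/-- The differential equations for the coefficients `ξ^i` of a vector field that projects to an
infinitesimal isometry of the `(x, y)`-plane and a translation of `t`. -/
structure IsBaseKilling (M : Set Total) (V : Total → Total) : Prop extends
    IsBaseConformal M V where
  totalDeriv_zero_zero : Set.EqOn (𝐃 0 (baseCoeff V 0 ∘ proj)) 0 (proj ⁻¹' M)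
  totalDeriv_time_time : Set.EqOn (𝐃 2 (baseCoeff V 2 ∘ proj)) 0 (proj ⁻¹' M)

variable {M : Set Total} {V : Total → Total} {ε γ : ℝ}

theorem IsInfinitesimalSymmetry.isBaseKilling (hM : IsOpen M) (hε : ε ≠ 0) (hγ : γ ≠ 0)
    (hV : IsInfinitesimalSymmetry ε γ M V) : IsBaseKilling M V where
  toIsBaseConformal := hV.isBaseConformal hM hε
  totalDeriv_zero_zero := hV.strain_eq_zero hM (hV.isBaseConformal hM hε) hε hγ
  totalDeriv_time_time z hz := by
    have hC := hV.isBaseConformal hM hε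
    rw [hV.totalDeriv_time_two hM hC hε hz, Pi.smul_apply,
      hV.strain_eq_zero hM hC hε hγ hz, Pi.zero_apply, smul_zero]

namespace IsBaseKilling

variable (hM : IsOpen M) (hV : ContDiffOn ℝ ∞ V M) (hK : IsBaseKilling M V)
include hM hV hK

theorem prolongApply_equation (ε γ : ℝ) : Set.EqOn (prolongApply V (equation ε γ))
    (totalViscoOp ε γ (fibreCoeff V 0 ∘ proj) - fibreCoeff V 1 ∘ proj) (proj ⁻¹' M) := by
  intro z hz
  rw [hK.toIsBaseConformal.prolongApply_equation hM hV ε γ hz]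
  simp [hK.totalDeriv_zero_zero hz, hK.totalDeriv_time_time hz,
    totalDeriv_eq_zero_of_eqOn_zero hM hK.totalDeriv_time_time 2 hz]

theorem totalDeriv_rotation (k : Fin 3) :
    Set.EqOn (𝐃 k (𝐃 1 (baseCoeff V 0 ∘ proj))) 0 (proj ⁻¹' M) := by
  have hX := IsDifferentialFunction.comp_proj (contDiffOn_baseCoeff hV 0)
  fin_cases k
  · exact (hX.totalDeriv_comm hM 1 0).trans
      (totalDeriv_eq_zero_of_eqOn_zero hM hK.totalDeriv_zero_zero 1)
  · intro z hz
    have hxx := totalDeriv_eq_zero_of_eqOn_zero hM hK.totalDeriv_zero_zero 0 hz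
    rw [hK.laplace_zero hM hV hz] at hxx
    exact neg_eq_zero.1 hxx
  · exact (hX.totalDeriv_comm hM 1 2).trans
      (totalDeriv_eq_zero_of_eqOn_zero hM hK.totalDeriv_time_zero 1)

theorem exists_killingField (hconn : IsPreconnected M) :
    ∃ c₁ c₂ c₃ c₄ : ℝ, ∀ p ∈ M, (V p).1 = killingField c₁ c₂ c₃ c₄ p.1 := by
  have hξ (i : Fin 3) := contDiffOn_baseCoeff hV i
  have hξα := fun i => hK.fibreDeriv_baseCoeff hM hV i
  have hXy := totalDeriv_comp_proj_of_fibreDeriv hM (hξ 0) (hξα 0) 1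
  obtain ⟨c₁, hc₁⟩ := exists_eq_sum_add (c := 0) hM hconn (contDiffOn_baseDeriv hM (hξ 0) 1)
    fun k => (totalDeriv_eqOn hM hXy.symm k).trans (hK.totalDeriv_rotation hM hV k)
  have hrot : Set.EqOn (𝐃 1 (baseCoeff V 0 ∘ proj)) (fun _ => c₁) (proj ⁻¹' M) := fun z hz => by
    rw [hXy hz, Function.comp_apply, hc₁ _ hz]
    simp
  obtain ⟨c₂, hc₂⟩ := exists_eq_sum_add (c := ![0, c₁, 0]) hM hconn (hξ 0) (by
    intro k
    fin_cases k
    exacts [hK.totalDeriv_zero_zero, hrot, hK.totalDeriv_time_zero])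
  obtain ⟨c₃, hc₃⟩ := exists_eq_sum_add (c := ![-c₁, 0, 0]) hM hconn (hξ 1) (by
    intro k
    fin_cases k
    · exact fun z hz => neg_eq_iff_eq_neg.1 ((hK.shear hz).symm.trans (hrot hz))
    exacts [hK.strain.trans hK.totalDeriv_zero_zero, hK.totalDeriv_time_one])
  obtain ⟨c₄, hc₄⟩ := exists_eq_sum_add (c := 0) hM hconn (hξ 2) (by
    intro k
    fin_cases k
    exacts [hK.totalDeriv_zero_time, hK.totalDeriv_one_time, hK.totalDeriv_time_time])
  refine ⟨c₁, c₂, c₃, c₄, fun p hp => funext fun i => ?_⟩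
  fin_cases i
  · exact (hc₂ p hp).trans (by simp [killingField, Fin.sum_univ_three])
  · exact (hc₃ p hp).trans (by simp [killingField, Fin.sum_univ_three])
  · exact (hc₄ p hp).trans (by simp [killingField])

end IsBaseKilling

end BaseKilling

section SymmetriesAreGenerators

variable {M : Set Total} {V : Total → Total} {ε γ c : ℝ} {F : Base → ℝ}

theorem totalViscoOp_fibreCoeff_zero (hM : IsOpen M) (hF : ContDiffOn ℝ ∞ F (Prod.fst '' M))
    (hφ : ∀ p ∈ M, fibreCoeff V 0 p = c * p.2 0 + F p.1) :
    Set.EqOn (totalViscoOp ε γ (fibreCoeff V 0 ∘ proj))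
      (c • (equation ε γ + jetCoord 1 0) + viscoOp ε γ F ∘ Prod.fst) (proj ⁻¹' M) := by
  have hu := IsDifferentialFunction.coord (M := M) 0 0
  have hFM : IsDifferentialFunction M (F ∘ Prod.fst) := .comp_proj (h := F ∘ Prod.fst)
    (hF.comp contDiff_fst.contDiffOn (Set.mapsTo_image _ _))
  have hφ' : Set.EqOn (fibreCoeff V 0 ∘ proj) (c • jetCoord 0 0 + F ∘ Prod.fst) (proj ⁻¹' M) :=
    fun z hz => hφ _ hz
  intro z hz
  rw [totalViscoOp_eqOn hM hφ' ε γ hz, (hu.const_smul c).totalViscoOp_add hM hFM ε γ hz,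
    Pi.add_apply, hu.totalViscoOp_const_smul hM ε γ c hz,
    totalViscoOp_comp_fst (isOpenMap_fst M hM) hF ε γ ⟨proj z, hz, rfl⟩, equation_eq]
  simp

namespace IsInfinitesimalSymmetry

theorem fibreDeriv_one_fibreCoeff_zero (hM : IsOpen M) (hε : ε ≠ 0)
    (hV : IsInfinitesimalSymmetry ε γ M V) :
    Set.EqOn (fibreDeriv 1 (fibreCoeff V 0)) 0 M := by
  refine eqOn_of_comp_proj fun z hz => ?_
  have hz' : proj (toShell ε γ z) ∈ M := (proj_toShell ε γ z).symm ▸ hz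
  have hξf (i : Fin 3) : fibreDeriv 1 (baseCoeff V i) (proj z) = 0 :=
    (hV.isBaseConformal hM hε).fibreDeriv_baseCoeff hM hV.smooth i 1 hz
  have hv (J : MultiIndex) (hJ : J 0 + J 1 + J 2 < 3) :
      (Pi.single ![2, 0, 1] 1 : MultiIndex → ℝ) J = 0 :=
    Pi.single_eq_of_ne (by rintro rfl; simp at hJ) _
  have h := hV.verticalDeriv_prolongApply hM hz' (equation_toShell ε γ z)
    (equation_vertical_of_third_order (w := 0) ε γ 1 hv (by simp) (by simp))
  rw [verticalDeriv_prolongApply_of_third_order hM hV.smooth hz' ε γ hv (w := 0) (by simp)] at h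
  simp (decide := true) only [proj_toShell, hξf, Pi.single_apply, if_true, if_false] at h
  simpa [hε] using h

theorem exists_fibreCoeff_zero (hM : IsOpen M) (hconn : IsPreconnected M)
    (hfib : ∀ q : Base, IsPreconnected {w : Fibre | (q, w) ∈ M}) (hε : ε ≠ 0)
    (hV : IsInfinitesimalSymmetry ε γ M V) :
    ∃ (c₅ : ℝ) (F : Base → ℝ), ContDiffOn ℝ ∞ F (Prod.fst '' M) ∧
      ∀ p ∈ M, fibreCoeff V 0 p = c₅ * p.2 0 + F p.1 := by
  have hφ := contDiffOn_fibreCoeff hV.smooth 0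
  obtain ⟨c₅, hc₅⟩ := exists_eq_sum_add (c := 0) hM hconn (contDiffOn_fibreDeriv hM hφ 0)
    fun k => hV.totalDeriv_fibreDeriv hM (hV.isBaseConformal hM hε) hε k
  refine ⟨c₅, exists_eq_clm_add_comp_fst (L := c₅ • (.proj 0 : Fibre →L[ℝ] ℝ)) hM hfib hφ
    fun p hp => ?_⟩
  ext1 w
  rw [ContinuousLinearMap.comp_apply, fderiv_total_apply]
  simp [hc₅ p hp, hV.fibreDeriv_one_fibreCoeff_zero hM hε hp, mul_comm]

theorem exists_generator (hM : IsOpen M) (hconn : IsPreconnected M)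
    (hfib : ∀ q : Base, IsPreconnected {w : Fibre | (q, w) ∈ M}) (hε : ε ≠ 0) (hγ : γ ≠ 0)
    (hV : IsInfinitesimalSymmetry ε γ M V) :
    ∃ (c₁ c₂ c₃ c₄ c₅ : ℝ) (F : Base → ℝ), ContDiffOn ℝ ∞ F (Prod.fst '' M) ∧
      ∀ p ∈ M, V p = generator ε γ c₁ c₂ c₃ c₄ c₅ F p := by
  have hK := hV.isBaseKilling hM hε hγ
  obtain ⟨c₁, c₂, c₃, c₄, hξ⟩ := hK.exists_killingField hM hV.smooth hconn
  obtain ⟨c₅, F, hF, hφ⟩ := hV.exists_fibreCoeff_zero hM hconn hfib hε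
  refine ⟨c₁, c₂, c₃, c₄, c₅, F, hF, fun p hp => Prod.ext (hξ p hp) (funext fun α => ?_)⟩
  fin_cases α
  · exact hφ p hp
  obtain ⟨z, rfl⟩ := proj_surjective p
  have hz : proj (toShell ε γ z) ∈ M := (proj_toShell ε γ z).symm ▸ hp
  have hinv := hV.invariance _ hz (equation_toShell ε γ z)
  rw [hK.prolongApply_equation hM hV.smooth ε γ hz, Pi.sub_apply,
    totalViscoOp_fibreCoeff_zero hM hF hφ hz, sub_eq_zero] at hinv
  simp only [Pi.add_apply, Pi.smul_apply, equation_toShell, zero_add, Function.comp_apply] at hinv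
  have hf : jetCoord 1 0 (toShell ε γ z) = (proj z).2 1 := congrFun
    (congrArg Prod.snd (proj_toShell ε γ z)) 1
  have hq : (toShell ε γ z).1 = (proj z).1 := (congrArg Prod.fst (proj_toShell ε γ z) :)
  rw [hf, hq, proj_toShell] at hinv
  exact hinv.symm

end IsInfinitesimalSymmetry

end SymmetriesAreGenerators

section GeneratorsAreSymmetries

variable {ε γ c₁ c₂ c₃ c₄ c₅ : ℝ} {F : Base → ℝ} {M : Set Total} {V : Total → Total}

theorem generator_eq (ε γ c₁ c₂ c₃ c₄ c₅ : ℝ) (F : Base → ℝ) (p : Total) :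
    generator ε γ c₁ c₂ c₃ c₄ c₅ F p
      = (killingField c₁ c₂ c₃ c₄ p.1, c₅ • p.2 + ![F p.1, viscoOp ε γ F p.1]) := by
  refine Prod.ext rfl (funext fun α => ?_)
  fin_cases α <;> rfl

theorem contDiffOn_generator (hM : IsOpen M) (hF : ContDiffOn ℝ ∞ F (Prod.fst '' M)) :
    ContDiffOn ℝ ∞ (generator ε γ c₁ c₂ c₃ c₄ c₅ F) M := by
  have hsource {G : Base → ℝ} (hG : ContDiffOn ℝ ∞ G (Prod.fst '' M)) :
      ContDiffOn ℝ ∞ (fun p : Total => G p.1) M :=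
    hG.comp contDiff_fst.contDiffOn (Set.mapsTo_image _ _)
  simp only [funext (generator_eq ε γ c₁ c₂ c₃ c₄ c₅ F)]
  refine ((contDiff_killingField c₁ c₂ c₃ c₄).comp contDiff_fst).contDiffOn.prodMk
    ((contDiff_snd.const_smul c₅).contDiffOn.add (contDiffOn_pi.2 fun α => ?_))
  fin_cases α
  · exact hsource hF
  · exact hsource (contDiffOn_viscoOp (isOpenMap_fst M hM) hF ε γ)

theorem fderiv_generator (hM : IsOpen M) (hF : ContDiffOn ℝ ∞ F (Prod.fst '' M)) {p : Total}
    (hp : p ∈ M) (v : Total) : fderiv ℝ (generator ε γ c₁ c₂ c₃ c₄ c₅ F) p v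
      = (fderiv ℝ (killingField c₁ c₂ c₃ c₄) p.1 v.1,
        c₅ • v.2 + ![fderiv ℝ F p.1 v.1, fderiv ℝ (viscoOp ε γ F) p.1 v.1]) := by
  have hΩ := isOpenMap_fst M hM
  have hsource {G : Base → ℝ} (hG : ContDiffOn ℝ ∞ G (Prod.fst '' M)) :
      HasFDerivAt (fun p : Total => G p.1) (fderiv ℝ G p.1 ∘L .fst ℝ Base Fibre) p :=
    (differentiableAt_of_contDiffOn hΩ hG ⟨p, hp, rfl⟩).hasFDerivAt.comp p hasFDerivAt_fst
  have hξ := ((contDiff_killingField c₁ c₂ c₃ c₄).differentiable (by simp) p.1).hasFDerivAt.comp p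
    hasFDerivAt_fst
  have hφ : HasFDerivAt (fun p : Total => ![F p.1, viscoOp ε γ F p.1])
      (ContinuousLinearMap.pi ![fderiv ℝ F p.1 ∘L .fst ℝ Base Fibre,
        fderiv ℝ (viscoOp ε γ F) p.1 ∘L .fst ℝ Base Fibre]) p := by
    refine hasFDerivAt_pi.2 fun α => ?_
    fin_cases α
    · exact hsource hF
    · exact hsource (contDiffOn_viscoOp hΩ hF ε γ)
  have h := hξ.prodMk ((hasFDerivAt_snd.const_smul c₅).add hφ)
  rw [funext (generator_eq ε γ c₁ c₂ c₃ c₄ c₅ F)]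
  refine (DFunLike.congr_fun h.fderiv v).trans (Prod.ext rfl (funext fun α => ?_))
  fin_cases α <;> rfl

theorem isBaseKilling_of_killingField (hM : IsOpen M)
    (hV : ∀ p ∈ M, (V p).1 = killingField c₁ c₂ c₃ c₄ p.1) : IsBaseKilling M V := by
  have hD (i k : Fin 3) : Set.EqOn (𝐃 k (baseCoeff V i ∘ proj))
      (fun _ => ![c₁ * (Pi.single k 1 : Base) 1, -c₁ * (Pi.single k 1 : Base) 0, 0] i)
      (proj ⁻¹' M) := by
    have hξ : Set.EqOn (baseCoeff V i ∘ proj)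
        ((fun q => killingField c₁ c₂ c₃ c₄ q i) ∘ Prod.fst) (proj ⁻¹' M) :=
      fun z hz => congrFun (hV _ hz) i
    have hsmooth := contDiff_killingField c₁ c₂ c₃ c₄
    intro z hz
    rw [totalDeriv_eqOn hM hξ k hz, totalDeriv_comp_fst isOpen_univ
      (contDiff_pi.1 hsmooth i).contDiffOn k (Set.mem_univ z.1), Function.comp_apply, pderiv,
      fderiv_apply (hsmooth.differentiable (by simp) z.1) i]
    exact congrFun (fderiv_killingField c₁ c₂ c₃ c₄ z.1 _) i
  refine ⟨⟨?_, ?_, ?_, ?_, ?_, ?_⟩, ?_, ?_⟩ <;> exact fun z hz => by simp [hD _ _ hz]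

theorem isInfinitesimalSymmetry_of_generator (hM : IsOpen M)
    (hF : ContDiffOn ℝ ∞ F (Prod.fst '' M))
    (hV : ∀ p ∈ M, V p = generator ε γ c₁ c₂ c₃ c₄ c₅ F p) :
    IsInfinitesimalSymmetry ε γ M V := by
  have hsmooth : ContDiffOn ℝ ∞ V M := (contDiffOn_generator hM hF).congr hV
  have hK : IsBaseKilling M V := isBaseKilling_of_killingField hM fun p hp =>
    congrArg Prod.fst (hV p hp)
  have hφ₀ (p : Total) (hp : p ∈ M) : fibreCoeff V 0 p = c₅ * p.2 0 + F p.1 :=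
    congrFun (congrArg Prod.snd (hV p hp)) 0
  refine ⟨hsmooth, fun z hz hshell => ?_⟩
  have hφ₁ : fibreCoeff V 1 (proj z) = c₅ * jetCoord 1 0 z + viscoOp ε γ F z.1 :=
    congrFun (congrArg Prod.snd (hV _ hz)) 1
  rw [hK.prolongApply_equation hM hsmooth ε γ hz, Pi.sub_apply,
    totalViscoOp_fibreCoeff_zero hM hF hφ₀ hz, Function.comp_apply, hφ₁]
  simp [hshell]

end GeneratorsAreSymmetries

section LieAlgebra

variable {ε γ c₁ c₂ c₃ c₄ c₅ d₁ d₂ d₃ d₄ d₅ : ℝ} {F G : Base → ℝ} {M : Set Total}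
  {V W : Total → Total}

theorem linearComb_generator (hM : IsOpen M) (hF : ContDiffOn ℝ ∞ F (Prod.fst '' M))
    (hG : ContDiffOn ℝ ∞ G (Prod.fst '' M))
    (hV : Set.EqOn V (generator ε γ c₁ c₂ c₃ c₄ c₅ F) M)
    (hW : Set.EqOn W (generator ε γ d₁ d₂ d₃ d₄ d₅ G) M) (a b : ℝ) :
    Set.EqOn (a • V + b • W)
      (generator ε γ (a * c₁ + b * d₁) (a * c₂ + b * d₂) (a * c₃ + b * d₃) (a * c₄ + b * d₄)
        (a * c₅ + b * d₅) (a • F + b • G)) M := by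
  intro p hp
  have hL := viscoOp_linearComb (isOpenMap_fst M hM) hF hG ε γ a b ⟨p, hp, rfl⟩
  simp only [Pi.add_apply, Pi.smul_apply, hV hp, hW hp, generator, hL]
  ext i <;> fin_cases i <;> simp <;> ring

/-- The inhomogeneous part of the `∂_u`-coefficient of the Lie bracket of two generators with base
fields `X`, `Y`, scaling constants `c`, `d` and inhomogeneous parts `F`, `G`. -/
def bracketSource (X Y : Base → Base) (c d : ℝ) (F G : Base → ℝ) : Base → ℝ :=
  lieDeriv X G - lieDeriv Y F + (d • F - c • G)

theorem contDiffOn_bracketSource {s : Set Base} (hs : IsOpen s) {X Y : Base → Base}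
    (hX : ContDiffOn ℝ ∞ X s) (hY : ContDiffOn ℝ ∞ Y s) (hF : ContDiffOn ℝ ∞ F s)
    (hG : ContDiffOn ℝ ∞ G s) (c d : ℝ) : ContDiffOn ℝ ∞ (bracketSource X Y c d F G) s :=
  ((contDiffOn_lieDeriv hs hX hG).sub (contDiffOn_lieDeriv hs hY hF)).add
    ((hF.const_smul d).sub (hG.const_smul c))

theorem viscoOp_bracketSource {s : Set Base} (hs : IsOpen s) (hF : ContDiffOn ℝ ∞ F s)
    (hG : ContDiffOn ℝ ∞ G s) (ε γ c₁ c₂ c₃ c₄ c₅ d₁ d₂ d₃ d₄ d₅ : ℝ) :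
    Set.EqOn
      (viscoOp ε γ (bracketSource (killingField c₁ c₂ c₃ c₄) (killingField d₁ d₂ d₃ d₄) c₅ d₅ F G))
      (bracketSource (killingField c₁ c₂ c₃ c₄) (killingField d₁ d₂ d₃ d₄) c₅ d₅
        (viscoOp ε γ F) (viscoOp ε γ G)) s := by
  have hXG := contDiffOn_lieDeriv hs (contDiff_killingField c₁ c₂ c₃ c₄).contDiffOn hG
  have hYF := contDiffOn_lieDeriv hs (contDiff_killingField d₁ d₂ d₃ d₄).contDiffOn hF
  have hsource : bracketSource (killingField c₁ c₂ c₃ c₄) (killingField d₁ d₂ d₃ d₄) c₅ d₅ F G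
      = (1 : ℝ) • ((1 : ℝ) • lieDeriv (killingField c₁ c₂ c₃ c₄) G
        + (-1 : ℝ) • lieDeriv (killingField d₁ d₂ d₃ d₄) F) + (1 : ℝ) • (d₅ • F + -c₅ • G) := by
    simp only [bracketSource, one_smul, neg_smul, sub_eq_add_neg]
  intro q hq
  rw [hsource, viscoOp_linearComb hs (contDiffOn_linearComb hXG hYF 1 (-1))
    (contDiffOn_linearComb hF hG d₅ (-c₅)) ε γ 1 1 hq]
  simp only [bracketSource, Pi.add_apply, Pi.sub_apply, Pi.smul_apply,
    viscoOp_linearComb hs hXG hYF ε γ _ _ hq, viscoOp_linearComb hs hF hG ε γ _ _ hq,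
    lieDeriv_killingField_viscoOp _ _ _ _ hs hF ε γ hq,
    lieDeriv_killingField_viscoOp _ _ _ _ hs hG ε γ hq, smul_eq_mul]
  ring

theorem lieBracket_generator (hM : IsOpen M) (hF : ContDiffOn ℝ ∞ F (Prod.fst '' M))
    (hG : ContDiffOn ℝ ∞ G (Prod.fst '' M))
    (hV : Set.EqOn V (generator ε γ c₁ c₂ c₃ c₄ c₅ F) M)
    (hW : Set.EqOn W (generator ε γ d₁ d₂ d₃ d₄ d₅ G) M) :
    Set.EqOn (VectorField.lieBracket ℝ V W)
      (generator ε γ 0 (d₁ * c₃ - c₁ * d₃) (c₁ * d₂ - d₁ * c₂) 0 0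
        (bracketSource (killingField c₁ c₂ c₃ c₄) (killingField d₁ d₂ d₃ d₄) c₅ d₅ F G)) M := by
  intro p hp
  have hL := viscoOp_bracketSource (isOpenMap_fst M hM) hF hG ε γ c₁ c₂ c₃ c₄ c₅ d₁ d₂ d₃ d₄ d₅
    ⟨p, hp, rfl⟩
  rw [VectorField.lieBracket, fderiv_eq_of_eqOn hM hV hp, fderiv_eq_of_eqOn hM hW hp, hV hp,
    hW hp, fderiv_generator hM hG hp, fderiv_generator hM hF hp, fderiv_killingField,
    fderiv_killingField, generator_eq, generator_eq, generator, hL]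
  simp only [bracketSource, lieDeriv, Pi.add_apply, Pi.sub_apply, Pi.smul_apply]
  ext i <;> fin_cases i <;> simp [killingField, Matrix.vecHead, Matrix.vecTail] <;> ring

end LieAlgebra

end Viscoelastic

end

open Viscoelastic in
theorem mainTheorem1 (ε γ : ℝ) (hε : ε ≠ 0) (hγ : γ ≠ 0)
    (M : Set Total) (hopen : IsOpen M) (hconn : IsPreconnected M)
    (hfib : ∀ q : Base, IsPreconnected {w : Fibre | (q, w) ∈ M}) :
    (∀ V : Total → Total,
      IsInfinitesimalSymmetry ε γ M V ↔
        ∃ (c₁ c₂ c₃ c₄ c₅ : ℝ) (F : Base → ℝ),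
          ContDiffOn ℝ ∞ F (Prod.fst '' M) ∧
          ∀ p ∈ M, V p = generator ε γ c₁ c₂ c₃ c₄ c₅ F p) ∧
    (∀ V W : Total → Total,
      IsInfinitesimalSymmetry ε γ M V → IsInfinitesimalSymmetry ε γ M W →
        (∀ a b : ℝ, IsInfinitesimalSymmetry ε γ M (a • V + b • W)) ∧
        IsInfinitesimalSymmetry ε γ M (VectorField.lieBracket ℝ V W)) := by
  have hgen {V : Total → Total} (hV : IsInfinitesimalSymmetry ε γ M V) :=
    hV.exists_generator hopen hconn hfib hε hγ
  refine ⟨fun V => ⟨hgen, ?_⟩, fun V W hV hW => ?_⟩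
  · rintro ⟨c₁, c₂, c₃, c₄, c₅, F, hF, hV⟩
    exact isInfinitesimalSymmetry_of_generator hopen hF hV
  obtain ⟨c₁, c₂, c₃, c₄, c₅, F, hF, hV⟩ := hgen hV
  obtain ⟨d₁, d₂, d₃, d₄, d₅, G, hG, hW⟩ := hgen hW
  refine ⟨fun a b => ?_, ?_⟩
  · exact isInfinitesimalSymmetry_of_generator hopen (contDiffOn_linearComb hF hG a b)
      (linearComb_generator hopen hF hG hV hW a b)
  · exact isInfinitesimalSymmetry_of_generator hopen
      (contDiffOn_bracketSource (isOpenMap_fst M hopen) (contDiff_killingField ..).contDiffOn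
        (contDiff_killingField ..).contDiffOn hF hG c₅ d₅)
      (lieBracket_generator hopen hF hG hV hW)
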